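/- **Setting.** Let $\mathcal X$ be a closed bounded subset of $\mathbb R^p$ (or of any metric space whose closed balls are compact), $\mu$ a finite Borel measure on $\mathcal X$, $\|\cdot\|$ the norm and $\langle\cdot,\cdot\rangle$ the inner product of $L^2(\mathcal X;\mu)$. Let $G=(V,\mathcal E)$ be a finite graph without cycles, $\mathcal N(v)$ the set of neighbours of $v$, and $\vec{\mathcal E}$ the set of directed edges $v\to u$ with $\{u,v\}\in\mathcal E$. Let $\psi_u:\mathcal X\to(0,\infty)$ ($u\in V$) and $\psi_{uv}:\mathcal X\times\mathcal X\to(0,\infty)$ ($\{u,v\}\in\mathcal E$) be continuous potentials. The belief propagation (BP) operator maps a family of probability densities $m=(m_{v\to u})$ to $$[F_{v\to u}(m)](x)=\kappa\int\psi_{uv}(x,y)\,\psi_v(y)\prod_{w\in\mathcal N(v)\setminus\{u\}}m_{w\to v}(y)\,\mu(dy),$$ with $\kappa$ normalizing the integral over $x$ to $1$; let $m^*$ be its fixed point, $F(m^*)=m^*$. Put $\beta_{uv}(y)=\psi_v(y)\int\psi_{uv}(x,y)\,\mu(dx)$ and $\Gamma_{uv}(x,y)=\psi_{uv}(x,y)\psi_v(y)/\beta_{uv}(y)$.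 Let $(\phi_j)_{j\ge1}$ be an orthonormal basis of $L^2(\mathcal X;\mu)$ consisting of measurable functions, let $r\ge1$ be such that $\phi_1,\dots,\phi_r$ are bounded, let $\Pi^r f=\sum_{j\le r}\langle f,\phi_j\rangle\phi_j$, and let $$A^r_{v\to u}=m^*_{v\to u}-\Pi^r m^*_{v\to u},\qquad \rho^2(A^r)=\big(\|A^r_{v\to u}\|^2\big)_{(v\to u)\in\vec{\mathcal E}},\qquad B_j=\max_{(v\to u)\in\vec{\mathcal E}}\ \sup_{y}\ \big|\langle\Gamma_{uv}(\cdot,y),\phi_j\rangle\big|.$$ Assume that for all $x\in\mathcal X$ and all $(v\to u)\in\vec{\mathcal E}$ $$\inf_y[\Pi^r\Gamma_{uv}(\cdot,y)](x)>0\quad\text{and}\quad |A^r_{v\to u}(x)|\le\tfrac12\inf_y[\Pi^r\Gamma_{uv}(\cdot,y)](x).$$ **Algorithm (SOSMP, with $k\ge1$ samples per update).** Set $a^0_{v\to u;j}=1/r$ for $j\le r$. At iteration $t=0,1,2,\dots$, for each $(v\to u)\in\vec{\mathcal E}$, draw, conditionally on the past, i.i.d. samples $Y_1,\dots,Y_k$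 from the probability density proportional to $\beta_{uv}(y)\prod_{w\in\mathcal N(v)\setminus\{u\}}\big[\sum_{j\le r}a^t_{w\to v;j}\phi_j(y)\big]_+$ (assumed not to vanish almost everywhere at $t=0$), and set $$a^{t+1}_{v\to u;j}=\Big(1-\frac1{t+1}\Big)a^t_{v\to u;j}+\frac1{t+1}\cdot\frac1k\sum_{i=1}^k\langle\Gamma_{uv}(\cdot,Y_i),\phi_j\rangle .$$ Let $m^t_{v\to u}=\sum_{j\le r}a^t_{v\to u;j}\phi_j$, $\Delta^t_{v\to u}=m^t_{v\to u}-\Pi^r m^*_{v\to u}$ and $\rho^2(\Delta^t)=\big(\|\Delta^t_{v\to u}\|^2\big)_{(v\to u)\in\vec{\mathcal E}}$. **Theorem.** There is a nilpotent matrix $N\in\mathbb R^{\vec{\mathcal E}\times\vec{\mathcal E}}$ with nonnegative entries, the same for every $k$ and every run of the algorithm, such that row $v\to u$ of $N$ has nonzero entries only in columns $w\to v$ with $w\in\mathcal N(v)\setminus\{u\}$ (and $N^\ell=0$ whenever all paths of $G$ have length at most $\ell$), and such that, with $\preceq$ and $|\cdot|$ taken elementwise: (a) $\rho^2(\Delta^t)$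 converges almost surely to the set $\{e\in\mathbb R^{\vec{\mathcal E}}:|e|\preceq N(I-N)^{-1}\rho^2(A^r)\}$, that is, its distance to this set tends to $0$ almost surely. (b) For all $t=1,2,\dots$, $$\mathbb E[\rho^2(\Delta^t)]\preceq\Big(6\sum_{j=1}^rB_j^2\Big)\frac{(I-\log t\,N)^{-1}}{t}\,(N\vec 1+16)+N(I-N)^{-1}\rho^2(A^r),$$ where $16$ stands for the vector with all entries $16$. In particular, if $N^{n+1}=0$, the positive part of $\mathbb E[\rho^2(\Delta^t)]-N(I-N)^{-1}\rho^2(A^r)$ is $O(\log^n t/t)$. -/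

import Mathlib

open MeasureTheory ProbabilityTheory Filter Topology Matrix

noncomputable section

/-- A pairwise Markov random field on the graph `G` with state space `X` at every node: strictly
positive node potentials `ψ_u(x_u)` and one strictly positive potential `ψ_{uv}(x_u, x_v)` per
undirected edge (`edgePot u v x_u x_v` and `edgePot v u x_v x_u` are the same number). -/
structure PairwiseMRF {V : Type*} (G : SimpleGraph V) (X : Type*) where
  nodePot : V → X → ℝ
  edgePot : V → V → X → X → ℝ
  nodePot_pos : ∀ v x, 0 < nodePot v x
  edgePot_pos : ∀ u v, G.Adj u v → ∀ x y, 0 < edgePot u v x y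
  edgePot_symm : ∀ u v, G.Adj u v → ∀ x y, edgePot u v x y = edgePot v u y x

/-- `φ 0, φ 1, …` are measurable functions whose classes form a Hilbert basis of `L²(μ)`. -/
def IsOrthonormalBasisL2 {X : Type*} [MeasurableSpace X] (μ : Measure X) (φ : ℕ → X → ℝ) : Prop :=
  (∀ j, Measurable (φ j)) ∧
    ∃ b : HilbertBasis ℕ ℝ (Lp ℝ 2 μ), ∀ j, (b j : X → ℝ) =ᵐ[μ] φ j

/-- The coefficient `⟨f, φ_j⟩ = ∫ f φ_j dμ`. -/
def basisCoef {X : Type*} [MeasurableSpace X] (μ : Measure X) (φ : ℕ → X → ℝ)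
    (f : X → ℝ) (j : ℕ) : ℝ :=
  ∫ x, f x * φ j x ∂μ

/-- The function `∑_{j < r} a_j φ_j`. -/
def expansion {X : Type*} (φ : ℕ → X → ℝ) {r : ℕ} (a : Fin r → ℝ) (x : X) : ℝ :=
  ∑ j, a j * φ j x

/-- The projection `Π^r f` on the span of the first `r` basis functions. -/
def projBasis {X : Type*} [MeasurableSpace X] (μ : Measure X) (φ : ℕ → X → ℝ) (r : ℕ)
    (f : X → ℝ) : X → ℝ :=
  expansion φ (fun j : Fin r => basisCoef μ φ f j)

/-- The squared norm `‖f‖²` in `L²(μ)`. -/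
def normSqL2 {X : Type*} [MeasurableSpace X] (μ : Measure X) (f : X → ℝ) : ℝ :=
  ∫ x, f x ^ 2 ∂μ

/-- Probability densities with respect to `μ`. -/
def IsDensity {X : Type*} [MeasurableSpace X] (μ : Measure X) (f : X → ℝ) : Prop :=
  (∀ x, 0 ≤ f x) ∧ Integrable f μ ∧ ∫ x, f x ∂μ = 1

/-- For a directed edge `d = (v → u)` these are the directed edges `w → v` with
`w ∈ N(v) \ {u}`, the ones whose messages enter the update of the message on `d`. -/
def incoming {V : Type*} [Fintype V] [DecidableEq V] (G : SimpleGraph V) [DecidableRel G.Adj]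
    (d : G.Dart) : Finset G.Dart :=
  Finset.univ.filter fun f => f.snd = d.fst ∧ f.fst ≠ d.snd

/-- Normalized density: the measure with density proportional to `f` with respect to `μ`. It is a
probability measure if and only if `f₊` has a finite positive integral (otherwise it is zero). -/
def normalizedMeasure {X : Type*} [MeasurableSpace X] (μ : Measure X) (f : X → ℝ) : Measure X :=
  ((μ.withDensity fun x => ENNReal.ofReal (f x)) Set.univ)⁻¹ •
    μ.withDensity fun x => ENNReal.ofReal (f x)

namespace PairwiseMRF

variable {V : Type*} [Fintype V] [DecidableEq V] {G : SimpleGraph V} [DecidableRel G.Adj]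
  {X : Type*} [MeasurableSpace X] (M : PairwiseMRF G X) (μ : Measure X) (φ : ℕ → X → ℝ)

/-- The unnormalized belief propagation update of the message on `d = (v → u)`:
`x_u ↦ ∫ ψ_{uv}(x_u, y) ψ_v(y) ∏_{w ∈ N(v) \ {u}} m_{w → v}(y) μ(dy)`. -/
def bpRaw (m : G.Dart → X → ℝ) (d : G.Dart) (x : X) : ℝ :=
  ∫ y, M.edgePot d.snd d.fst x y * M.nodePot d.fst y * ∏ f ∈ incoming G d, m f y ∂μ

/-- The belief propagation update operator. -/
def bpUpdate (m : G.Dart → X → ℝ) (d : G.Dart) (x : X) : ℝ :=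
  M.bpRaw μ m d x / ∫ x', M.bpRaw μ m d x' ∂μ

/-- `m` is a family of message densities fixed by the belief propagation operator. -/
def IsBPFixedPoint (m : G.Dart → X → ℝ) : Prop :=
  (∀ d, IsDensity μ (m d)) ∧ M.bpUpdate μ m = m

/-- `β_{uv}(y) = ψ_v(y) ∫ ψ_{uv}(x, y) μ(dx)` for `d = (v → u)`. -/
def beta (d : G.Dart) (y : X) : ℝ :=
  M.nodePot d.fst y * ∫ x, M.edgePot d.snd d.fst x y ∂μ

/-- The normalized compatibility function `Γ_{uv}(x, y) = ψ_{uv}(x, y) ψ_v(y) / β_{uv}(y)`. -/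
def compat (d : G.Dart) (x y : X) : ℝ :=
  M.edgePot d.snd d.fst x y * (M.nodePot d.fst y / M.beta μ d y)

/-- `⟨Γ_{uv}(·, y), φ_j⟩`. -/
def compatCoef (d : G.Dart) (j : ℕ) (y : X) : ℝ :=
  basisCoef μ φ (fun x => M.compat μ d x y) j

/-- `B_j = max_{v → u} sup_y |⟨Γ_{uv}(·, y), φ_j⟩|`. -/
def bound (j : ℕ) : ℝ :=
  ⨆ d : G.Dart, ⨆ y : X, |M.compatCoef μ φ d j y|

/-- The approximation error `A^r_{v → u} = m*_{v → u} - Π^r m*_{v → u}`. -/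
def approxErr (r : ℕ) (mstar : G.Dart → X → ℝ) (d : G.Dart) (x : X) : ℝ :=
  mstar d x - projBasis μ φ r (mstar d) x

/-- The vector `ρ²(A^r)` of squared norms of the approximation errors. -/
def approxErrVec (r : ℕ) (mstar : G.Dart → X → ℝ) (d : G.Dart) : ℝ :=
  normSqL2 μ (approxErr μ φ r mstar d)

/-- `inf_y Π^r(Γ_{uv}(·, y))(x) > 0` and `|A^r_{v → u}(x)| ≤ ½ inf_y Π^r(Γ_{uv}(·, y))(x)` for
all `x` and all directed edges. -/
def ApproxCondition (r : ℕ) (mstar : G.Dart → X → ℝ) : Prop :=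
  ∀ (d : G.Dart) (x : X),
    0 < (⨅ y : X, projBasis μ φ r (fun x' => M.compat μ d x' y) x) ∧
    |approxErr μ φ r mstar d x| ≤
      1 / 2 * ⨅ y : X, projBasis μ φ r (fun x' => M.compat μ d x' y) x

/-- The coefficients `a^t` computed by SOSMP from the samples `y s d i` (iteration `s`, directed
edge `d`, `i`-th of the `k` samples): `a^0 = 1/r`, and
`a^{t+1} = (1 - η) a^t + η (1/k) ∑_i ⟨Γ(·, y t d i), φ_j⟩` with step size `η = 1/(t+1)`. -/
def sosmpCoef (r : ℕ) {k : ℕ} (y : ℕ → G.Dart → Fin k → X) : ℕ → G.Dart → Fin r → ℝ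
  | 0 => fun _ _ => 1 / (r : ℝ)
  | t + 1 => fun d j =>
      (1 - 1 / ((t : ℝ) + 1)) * sosmpCoef r y t d j +
        1 / ((t : ℝ) + 1) * (1 / (k : ℝ) * ∑ i, M.compatCoef μ φ d j (y t d i))

/-- The law from which SOSMP samples on `d = (v → u)` when the current coefficients are `a`: its
density is proportional to `β_{uv}(y) ∏_{w ∈ N(v) \ {u}} [∑_j a_{w → v; j} φ_j(y)]₊`. -/
def sampleLaw {r : ℕ} (a : G.Dart → Fin r → ℝ) (d : G.Dart) : Measure X :=
  normalizedMeasure μ fun y =>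
    M.beta μ d y * ∏ f ∈ incoming G d, max 0 (expansion φ (a f) y)

/-- The random variables `Y t ω d i` (iteration `t`, directed edge `d`, `i`-th sample) are the
samples drawn in a run of SOSMP with `r` coefficients and `k` samples per update: conditionally on
all samples of the earlier iterations, the `k` samples on each directed edge `d` at iteration `t`
are i.i.d. from `sampleLaw` at the current coefficients. No joint law across the directed edges
within one iteration is imposed. -/
def IsSOSMPRun (r k : ℕ) {Ω : Type*} [MeasurableSpace Ω] (P : Measure Ω)
    (Y : ℕ → Ω → G.Dart → Fin k → X) : Prop :=
  (∀ t, Measurable (Y t)) ∧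
    ∀ (t : ℕ) (d : G.Dart) (A : Set (Fin k → X)), MeasurableSet A →
      P[((fun ω => Y t ω d) ⁻¹' A).indicator (fun _ => (1 : ℝ)) |
          MeasurableSpace.comap (fun ω (s : Fin t) => Y s ω) inferInstance]
        =ᵐ[P] fun ω =>
          (Measure.pi fun _ : Fin k =>
            M.sampleLaw μ φ (M.sosmpCoef μ φ r (fun s => Y s ω) t) d).real A

/-- The error vector `ρ²(Δ^t)`, with entries `‖m^t_{v → u} - Π^r(m*_{v → u})‖²`, where
`m^t_{v → u} = ∑_j a^t_{v → u; j} φ_j`. -/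
def estErrVec (r : ℕ) (mstar : G.Dart → X → ℝ) {k : ℕ} (y : ℕ → G.Dart → Fin k → X) (t : ℕ)
    (d : G.Dart) : ℝ :=
  normSqL2 μ fun x =>
    expansion φ (M.sosmpCoef μ φ r y t d) x - projBasis μ φ r (mstar d) x

end PairwiseMRF

/-- The vector `N (I - N)⁻¹ ρ`. -/
def errFloor {ι : Type*} [Fintype ι] [DecidableEq ι] (N : Matrix ι ι ℝ) (ρ : ι → ℝ) : ι → ℝ :=
  (N * (1 - N)⁻¹) *ᵥ ρ

/-- The set `{e : |e| ⪯ N (I - N)⁻¹ ρ}`. -/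
def errBall {ι : Type*} [Fintype ι] [DecidableEq ι] (N : Matrix ι ι ℝ) (ρ : ι → ℝ) :
    Set (EuclideanSpace ℝ ι) :=
  {e | ∀ i, |e i| ≤ errFloor N ρ i}

end

/-! The step size is 1 at t = 0, so the initial coefficients are erased and for t ≥ 1 each a^t is
the plain average of the sampled coefficients of Γ (`sosmpCoef_eq_average`). Hence |a^t_j| ≤ B_j,
and m^t is an average of functions Π^r Γ(·, y), which are positive by `ApproxCondition`; the
positive part in the sampling law is then inactive.

Split every sampled coefficient into its conditional mean given the past and a noise term. The noise
is a bounded martingale difference: its running average has second moment at most (2B_j)²/t and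
tends to 0 almost surely (`ae_tendsto_average_of_orthogonal`). The conditional mean and the
coefficient of m* are weighted averages of the same function ⟨Γ(·, y), φ_j⟩, with weights β∏m^s and
β∏m*. Such averages are Lipschitz in the weight, so Cauchy–Schwarz and Pythagoras bound the squared
bias on the edge d by B_j² κ_d times the sum of ‖Δ^s‖² + ‖A^r‖² over the incoming edges
(`exists_bias_le`). Since κ_d does not depend on the run, N = 6 κ_d ∑ B_j² on incoming edges serves
all runs.

With ρ = ρ²(A^r) this yields ρ²(Δ^t) ⪯ (1/t) ∑_{1≤s<t} (1/3) N(ρ²(Δ^s) + ρ) + R_t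
(`ae_estErrVec_le`), where R_t → 0 almost surely and E R_t ≤ 16 ∑ B_j² / t. The floor F = N(I -
N)⁻¹ρ solves F = N(F + ρ). For (b), induction on t bounds the expectations. For (a), convergence of
the excess over F propagates by Cesàro averaging from the zero rows of N to all rows; this ends
because N follows non-backtracking walks in a forest and so is nilpotent. -/

/-! ### Nonnegative nilpotent matrices and averaged recursions. -/

section NilpotentMatrix

variable {ι : Type*} [Fintype ι] {N : Matrix ι ι ℝ}

theorem Matrix.mulVec_mono_of_nonneg (hN : ∀ d f, 0 ≤ N d f) {v w : ι → ℝ} (h : ∀ i, v i ≤ w i)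
    (d : ι) : (N *ᵥ v) d ≤ (N *ᵥ w) d :=
  Finset.sum_le_sum fun f _ => mul_le_mul_of_nonneg_left (h f) (hN d f)

theorem Matrix.mulVec_nonneg_of_nonneg (hN : ∀ d f, 0 ≤ N d f) {v : ι → ℝ} (h : ∀ i, 0 ≤ v i)
    (d : ι) : 0 ≤ (N *ᵥ v) d :=
  Finset.sum_nonneg fun f _ => mul_nonneg (hN d f) (h f)

variable [DecidableEq ι]

/-- The Neumann series of a nilpotent matrix terminates, so I - cN is invertible for every c. No
smallness is needed, which matters for c = log t. -/
theorem Matrix.one_sub_smul_mul_geom_sum {m : ℕ} (hm : N ^ m = 0) (c : ℝ) :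
    (1 - c • N) * ∑ k ∈ Finset.range m, c ^ k • N ^ k = 1 := by
  have h := mul_neg_geom_sum (c • N) m
  simpa only [smul_pow, hm, smul_zero, sub_zero] using h

theorem Matrix.inv_one_sub_smul {m : ℕ} (hm : N ^ m = 0) (c : ℝ) :
    (1 - c • N)⁻¹ = ∑ k ∈ Finset.range m, c ^ k • N ^ k :=
  inv_eq_right_inv (one_sub_smul_mul_geom_sum hm c)

theorem Matrix.inv_one_sub_smul_mulVec_apply {m : ℕ} (hm : N ^ m = 0) (c : ℝ) (q : ι → ℝ) (d : ι) :
    ((1 - c • N)⁻¹ *ᵥ q) d = ∑ k ∈ Finset.range m, c ^ k * (N ^ k *ᵥ q) d := by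
  rw [inv_one_sub_smul hm, sum_mulVec, Finset.sum_apply]
  simp [smul_mulVec]

/-- The form w = q + cNw is the one in which the resolvent closes the induction in
`le_of_averaged_recursion`. -/
theorem Matrix.inv_one_sub_smul_mulVec_eq {m : ℕ} (hm : N ^ m = 0) (c : ℝ) (q : ι → ℝ) :
    (1 - c • N)⁻¹ *ᵥ q = q + c • (N *ᵥ ((1 - c • N)⁻¹ *ᵥ q)) := by
  have h : (1 - c • N) *ᵥ ((1 - c • N)⁻¹ *ᵥ q) = q := by
    rw [mulVec_mulVec, inv_one_sub_smul hm, one_sub_smul_mul_geom_sum hm, one_mulVec]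
  rw [sub_mulVec, one_mulVec, smul_mulVec] at h
  exact sub_eq_iff_eq_add.mp h

theorem Matrix.inv_one_sub_smul_mulVec_nonneg (hN : ∀ d f, 0 ≤ N d f) {m : ℕ} (hm : N ^ m = 0)
    {c : ℝ} (hc : 0 ≤ c) {q : ι → ℝ} (hq : ∀ i, 0 ≤ q i) (d : ι) :
    0 ≤ ((1 - c • N)⁻¹ *ᵥ q) d := by
  rw [inv_one_sub_smul_mulVec_apply hm]
  exact Finset.sum_nonneg fun k _ => mul_nonneg (pow_nonneg hc k)
    (mulVec_nonneg_of_nonneg (pow_apply_nonneg hN k) hq d)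

theorem Matrix.inv_one_sub_smul_mulVec_mono (hN : ∀ d f, 0 ≤ N d f) {m : ℕ} (hm : N ^ m = 0)
    {c c' : ℝ} (hc : 0 ≤ c) (hcc' : c ≤ c') {q : ι → ℝ} (hq : ∀ i, 0 ≤ q i) (d : ι) :
    ((1 - c • N)⁻¹ *ᵥ q) d ≤ ((1 - c' • N)⁻¹ *ᵥ q) d := by
  rw [inv_one_sub_smul_mulVec_apply hm, inv_one_sub_smul_mulVec_apply hm]
  exact Finset.sum_le_sum fun k _ => mul_le_mul_of_nonneg_right (pow_le_pow_left₀ hc hcc' k)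
    (mulVec_nonneg_of_nonneg (pow_apply_nonneg hN k) hq d)

theorem errFloor_eq_mulVec (N : Matrix ι ι ℝ) (ρ : ι → ℝ) :
    errFloor N ρ = N *ᵥ ((1 - (1 : ℝ) • N)⁻¹ *ᵥ ρ) := by
  rw [errFloor, one_smul, mulVec_mulVec]

theorem errFloor_nonneg (hN : ∀ d f, 0 ≤ N d f) {m : ℕ} (hm : N ^ m = 0)
    {ρ : ι → ℝ} (hρ : ∀ i, 0 ≤ ρ i) (d : ι) : 0 ≤ errFloor N ρ d := by
  rw [errFloor_eq_mulVec]
  exact mulVec_nonneg_of_nonneg hN (inv_one_sub_smul_mulVec_nonneg hN hm zero_le_one hρ) d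

/-- The floor is the fixed point of x ↦ N(x + ρ), so subtracting it removes the source ρ from the
recursions below. -/
theorem mulVec_errFloor_add {m : ℕ} (hm : N ^ m = 0) (ρ : ι → ℝ) :
    N *ᵥ (errFloor N ρ + ρ) = errFloor N ρ := by
  have h := inv_one_sub_smul_mulVec_eq hm 1 ρ
  rw [one_smul ℝ (N *ᵥ _), ← errFloor_eq_mulVec, add_comm] at h
  rw [← h, ← errFloor_eq_mulVec]

/-- The constant 1 would fail at t = 2, where the sum is 1 > log 2. The bound 1 + log t ≤ 3 log t
only needs log 2 ≥ 1/2, and the 3 is absorbed by the factor 1/3 of the recursion. -/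
theorem sum_one_div_Ico_le (t : ℕ) :
    ∑ s ∈ Finset.Ico 1 t, 1 / (s : ℝ) ≤ 3 * Real.log t := by
  rcases Nat.lt_or_ge t 2 with ht | ht
  · interval_cases t <;> simp
  · have h1 : ∑ s ∈ Finset.Ico 1 t, 1 / (s : ℝ) ≤ ((harmonic (t - 1) : ℚ) : ℝ) := by
      rw [Finset.sum_Ico_eq_sum_range, harmonic, Rat.cast_sum]
      refine le_of_eq (Finset.sum_congr rfl fun i _ => ?_)
      push_cast
      rw [one_div, add_comm]
    have h2 := harmonic_le_one_add_log (t - 1)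
    have h3 : Real.log ((t - 1 : ℕ) : ℝ) ≤ Real.log t :=
      Real.log_le_log (by exact_mod_cast (by omega : 0 < t - 1)) (by exact_mod_cast Nat.sub_le t 1)
    have h4 : Real.log 2 ≤ Real.log t := Real.log_le_log (by norm_num) (by exact_mod_cast ht)
    linarith [Real.log_two_gt_d9]

/-- A vector recursion in which each entry is bounded by an average of the past along a
nonnegative nilpotent matrix, up to an error of order `1/t`. -/
theorem le_of_averaged_recursion (hN : ∀ d f, 0 ≤ N d f) {m : ℕ} (hm : N ^ m = 0)
    {ρ : ι → ℝ} (hρ : ∀ i, 0 ≤ ρ i) {x : ℕ → ι → ℝ} {S : ℝ} (hS : 0 ≤ S)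
    (hx : ∀ t : ℕ, 1 ≤ t → ∀ d, (t : ℝ) * x t d ≤
      ∑ s ∈ Finset.Ico 1 t, 1 / 3 * (N *ᵥ (x s + ρ)) d + 16 * S)
    {t : ℕ} (ht : 1 ≤ t) (d : ι) :
    x t d ≤ (6 * S) * (((1 - Real.log (t : ℝ) • N)⁻¹ *ᵥ
      (N *ᵥ (fun _ => (1 : ℝ)) + fun _ => (16 : ℝ))) d / (t : ℝ)) + errFloor N ρ d := by
  set q : ι → ℝ := N *ᵥ (fun _ => (1 : ℝ)) + fun _ => (16 : ℝ) with hq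
  set F := errFloor N ρ with hF
  have hq16 : ∀ i, 16 ≤ q i := fun i => by
    have := mulVec_nonneg_of_nonneg hN (v := fun _ => (1 : ℝ)) (fun _ => zero_le_one) i
    simp only [hq, Pi.add_apply]
    linarith
  have hq0 : ∀ i, 0 ≤ q i := fun i => by linarith [hq16 i]
  induction t using Nat.strong_induction_on generalizing d with
  | _ t ih =>
    have htpos : (0 : ℝ) < t := by exact_mod_cast ht
    have hlog : 0 ≤ Real.log t := Real.log_nonneg (by exact_mod_cast ht)
    set w := (1 - Real.log (t : ℝ) • N)⁻¹ *ᵥ q with hw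
    have hw0 : ∀ i, 0 ≤ w i := inv_one_sub_smul_mulVec_nonneg hN hm hlog hq0
    have hF0 : ∀ i, 0 ≤ F i := errFloor_nonneg hN hm hρ
    have hNw0 : 0 ≤ (N *ᵥ w) d := mulVec_nonneg_of_nonneg hN hw0 d
    -- The resolvent increases with log s ≤ log t, so the single vector w serves all past times and
    -- only the factors 1/s remain to be summed.
    have hstep : ∀ s ∈ Finset.Ico 1 t, 1 / 3 * (N *ᵥ (x s + ρ)) d ≤
        1 / 3 * F d + 2 * S * (N *ᵥ w) d * (1 / (s : ℝ)) := by
      intro s hs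
      rw [Finset.mem_Ico] at hs
      have hspos : (0 : ℝ) < s := by exact_mod_cast hs.1
      have hle : ∀ f, (x s + ρ) f ≤ ((F + ρ) + (6 * S / s) • w) f := by
        intro f
        have h1 := ih s hs.2 hs.1 f
        have h2 : ((1 - Real.log (s : ℝ) • N)⁻¹ *ᵥ q) f ≤ w f :=
          inv_one_sub_smul_mulVec_mono hN hm (Real.log_nonneg (by exact_mod_cast hs.1))
            (Real.log_le_log hspos (by exact_mod_cast hs.2.le)) hq0 f
        have h3 : 6 * S * (((1 - Real.log (s : ℝ) • N)⁻¹ *ᵥ q) f / s) ≤ 6 * S / s * w f := by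
          rw [mul_div_assoc', div_mul_eq_mul_div]
          gcongr
        simp only [Pi.add_apply, Pi.smul_apply, smul_eq_mul]
        linarith
      have h := mulVec_mono_of_nonneg hN hle d
      rw [mulVec_add N (F + ρ), mulVec_errFloor_add hm, mulVec_smul] at h
      simp only [Pi.add_apply, Pi.smul_apply, smul_eq_mul] at h
      calc 1 / 3 * (N *ᵥ (x s + ρ)) d ≤ 1 / 3 * (F d + 6 * S / s * (N *ᵥ w) d) := by
            gcongr
        _ = _ := by ring
    have hsum := Finset.sum_le_sum hstep
    rw [Finset.sum_add_distrib, Finset.sum_const, Nat.card_Ico, nsmul_eq_mul,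
      ← Finset.mul_sum _ _ (2 * S * (N *ᵥ w) d)] at hsum
    have hh : 2 * S * (N *ᵥ w) d * ∑ s ∈ Finset.Ico 1 t, 1 / (s : ℝ) ≤
        2 * S * (N *ᵥ w) d * (3 * Real.log t) :=
      mul_le_mul_of_nonneg_left (sum_one_div_Ico_le t) (by positivity)
    have hcast : ((t - 1 : ℕ) : ℝ) * (1 / 3 * F d) ≤ t * F d := by
      rw [Nat.cast_sub ht]
      have := hF0 d
      push_cast
      nlinarith [mul_nonneg htpos.le this]
    have hweq : w d = q d + Real.log t * (N *ᵥ w) d := by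
      have := congrFun (inv_one_sub_smul_mulVec_eq hm (Real.log t) q) d
      simpa only [Pi.add_apply, Pi.smul_apply, smul_eq_mul] using this
    -- The past contributes 2S · 3 log t · Nw = 6S log t · Nw, and 16S ≤ 6Sq because q ≥ 16. By w =
    -- q + log t · Nw the two add up to at most 6Sw.
    have hmain : t * x t d ≤ t * F d + 6 * S * w d := by
      have := hx t ht d
      rw [hweq]
      nlinarith [mul_le_mul_of_nonneg_left (hq16 d) hS]
    have : x t d ≤ (t * F d + 6 * S * w d) / t := by
      rw [le_div_iff₀ htpos]
      linarith
    calc x t d ≤ (t * F d + 6 * S * w d) / t := this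
      _ = 6 * S * (w d / t) + F d := by
        field_simp
        ring

/-- The excess over the floor vanishes in the limit for a vector recursion in which each entry is
bounded by an average of the past along a nonnegative nilpotent matrix. -/
theorem tendsto_posPart_of_averaged_recursion (hN : ∀ d f, 0 ≤ N d f) {m : ℕ} (hm : N ^ m = 0)
    {ρ : ι → ℝ} (hρ : ∀ i, 0 ≤ ρ i) {x R : ℕ → ι → ℝ}
    (hR : ∀ d, Tendsto (fun t => R t d) atTop (𝓝 0))
    (hx : ∀ t : ℕ, 1 ≤ t → ∀ d, x t d ≤
      1 / t * ∑ s ∈ Finset.Ico 1 t, 1 / 3 * (N *ᵥ (x s + ρ)) d + R t d) (d : ι) :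
    Tendsto (fun t => max 0 (x t d - errFloor N ρ d)) atTop (𝓝 0) := by
  set F := errFloor N ρ with hF
  have hF0 : ∀ i, 0 ≤ F i := errFloor_nonneg hN hm hρ
  set y : ℕ → ι → ℝ := fun t d => max 0 (x t d - F d) with hy
  have hy0 : ∀ t d, 0 ≤ y t d := fun t d => le_max_left _ _
  have hyrec : ∀ t : ℕ, 1 ≤ t → ∀ d, y t d ≤
      (t : ℝ)⁻¹ * ∑ s ∈ Finset.range t, 1 / 3 * (N *ᵥ y s) d + |R t d| := by
    intro t ht d
    have htpos : (0 : ℝ) < t := by exact_mod_cast ht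
    have hNy : ∀ s, 0 ≤ 1 / 3 * (N *ᵥ y s) d := fun s =>
      mul_nonneg (by norm_num) (mulVec_nonneg_of_nonneg hN (hy0 s) d)
    have hstep : ∀ s ∈ Finset.Ico 1 t, 1 / 3 * (N *ᵥ (x s + ρ)) d ≤
        1 / 3 * F d + 1 / 3 * (N *ᵥ y s) d := by
      intro s _
      have hle : ∀ f, (x s + ρ) f ≤ ((F + ρ) + y s) f := by
        intro f
        have : x s f - F f ≤ y s f := le_max_right _ _
        simp only [Pi.add_apply]
        linarith
      have h := mulVec_mono_of_nonneg hN hle d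
      rw [mulVec_add N (F + ρ), mulVec_errFloor_add hm] at h
      simp only [Pi.add_apply] at h
      linarith
    have hsum := Finset.sum_le_sum hstep
    rw [Finset.sum_add_distrib, Finset.sum_const, Nat.card_Ico, nsmul_eq_mul] at hsum
    -- Adding the nonnegative term s = 0 turns the sum into a genuine Cesàro mean.
    have hsub : ∑ s ∈ Finset.Ico 1 t, 1 / 3 * (N *ᵥ y s) d ≤
        ∑ s ∈ Finset.range t, 1 / 3 * (N *ᵥ y s) d := by
      refine Finset.sum_le_sum_of_subset_of_nonneg ?_ fun s _ _ => hNy s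
      intro s hs
      simp only [Finset.mem_Ico, Finset.mem_range] at hs ⊢
      exact hs.2
    have hcast : ((t - 1 : ℕ) : ℝ) * (1 / 3 * F d) ≤ t * F d := by
      rw [Nat.cast_sub ht]
      have := hF0 d
      push_cast
      nlinarith [mul_nonneg htpos.le this]
    refine max_le (add_nonneg (mul_nonneg (by positivity) (Finset.sum_nonneg fun s _ => hNy s))
      (abs_nonneg _)) ?_
    have h1 := hx t ht d
    have h2 : 1 / (t : ℝ) * ∑ s ∈ Finset.Ico 1 t, 1 / 3 * (N *ᵥ (x s + ρ)) d ≤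
        1 / (t : ℝ) * (t * F d + ∑ s ∈ Finset.range t, 1 / 3 * (N *ᵥ y s) d) :=
      mul_le_mul_of_nonneg_left (by linarith) (by positivity)
    have h3 : 1 / (t : ℝ) * (t * F d + ∑ s ∈ Finset.range t, 1 / 3 * (N *ᵥ y s) d) =
        F d + (t : ℝ)⁻¹ * ∑ s ∈ Finset.range t, 1 / 3 * (N *ᵥ y s) d := by
      field_simp
    linarith [le_abs_self (R t d)]
  -- Induction on the depth of d: the first power of N whose row d vanishes. Depth 0 cannot occur,
  -- as the identity has no zero row.
  have key : ∀ (n : ℕ) (d : ι), (∀ f, (N ^ n) d f = 0) → Tendsto (fun t => y t d) atTop (𝓝 0) := by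
    intro n
    induction n with
    | zero =>
      intro d h
      simpa using h d
    | succ n ih =>
      intro d h
      -- Nonnegativity excludes cancellation in N · N^n, so every e that feeds d has smaller depth.
      have hrow : ∀ e, N d e = 0 ∨ ∀ f, (N ^ n) e f = 0 := by
        intro e
        by_contra! hcon
        obtain ⟨hde, f, hef⟩ := hcon
        have hsum := h f
        rw [pow_succ', mul_apply, Finset.sum_eq_zero_iff_of_nonneg fun e _ =>
          mul_nonneg (hN d e) (pow_apply_nonneg hN n e f)] at hsum
        exact mul_ne_zero hde hef (hsum e (Finset.mem_univ e))
      have hNy : Tendsto (fun s => 1 / 3 * (N *ᵥ y s) d) atTop (𝓝 0) := by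
        have : Tendsto (fun s => ∑ e, N d e * y s e) atTop (𝓝 (∑ _e : ι, (0 : ℝ))) := by
          refine tendsto_finsetSum _ fun e _ => ?_
          rcases hrow e with he | he
          · simp [he]
          · simpa using (ih e he).const_mul (N d e)
        rw [Finset.sum_const_zero] at this
        have h3 := this.const_mul (1 / 3)
        rwa [mul_zero] at h3
      have hlim : Tendsto (fun t : ℕ => (t : ℝ)⁻¹ * ∑ s ∈ Finset.range t, 1 / 3 * (N *ᵥ y s) d +
          |R t d|) atTop (𝓝 0) := by
        simpa using hNy.cesaro.add (hR d).abs
      refine tendsto_of_tendsto_of_tendsto_of_le_of_le' tendsto_const_nhds hlim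
        (Eventually.of_forall fun t => hy0 t d) ?_
      filter_upwards [eventually_ge_atTop 1] with t ht using hyrec t ht d
  exact key m d fun f => by rw [hm]; rfl

/-- The resolvent is a polynomial in log t of degree at most n, since the Neumann series stops at
N^n. -/
theorem isBigO_log_pow_div {n : ℕ} (hn : N ^ (n + 1) = 0) (q : ι → ℝ) (d : ι) :
    (fun t : ℕ => ((1 - Real.log (t : ℝ) • N)⁻¹ *ᵥ q) d / (t : ℝ)) =O[atTop]
      fun t : ℕ => Real.log t ^ n / t := by
  have hlog : Tendsto (fun t : ℕ => Real.log t) atTop atTop :=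
    Real.tendsto_log_atTop.comp tendsto_natCast_atTop_atTop
  have hk : ∀ k ∈ Finset.range (n + 1), (fun t : ℕ => Real.log t ^ k * (N ^ k *ᵥ q) d) =O[atTop]
      fun t : ℕ => Real.log t ^ n := by
    intro k hk
    refine Asymptotics.IsBigO.of_bound |(N ^ k *ᵥ q) d| ?_
    filter_upwards [hlog.eventually_ge_atTop 1] with t ht
    rw [norm_mul, mul_comm, Real.norm_eq_abs ((N ^ k *ᵥ q) d), norm_pow, norm_pow,
      Real.norm_of_nonneg (zero_le_one.trans ht)]
    exact mul_le_mul_of_nonneg_left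
      (pow_le_pow_right₀ ht (Nat.lt_succ_iff.mp (Finset.mem_range.mp hk))) (abs_nonneg _)
  simp_rw [inv_one_sub_smul_mulVec_apply hn, div_eq_mul_inv]
  exact (Asymptotics.IsBigO.fun_sum hk).mul (Asymptotics.isBigO_refl _ _)

/-- The distance of a nonnegative vector to the box is controlled by its excess over the box. -/
theorem infDist_errBall_le {ρ : ι → ℝ} (hF : ∀ i, 0 ≤ errFloor N ρ i) {e : ι → ℝ}
    (he : ∀ i, 0 ≤ e i) :
    Metric.infDist (WithLp.toLp 2 e) (errBall N ρ) ≤ ∑ i, max 0 (e i - errFloor N ρ i) := by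
  -- Clipping e at the floor gives a point of the box that differs from e exactly by the excess.
  have hmem : (WithLp.toLp 2 fun i => min (e i) (errFloor N ρ i) : EuclideanSpace ℝ ι) ∈
      errBall N ρ := by
    intro i
    simp only
    rw [abs_of_nonneg (le_min (he i) (hF i))]
    exact min_le_right _ _
  refine (Metric.infDist_le_dist_of_mem hmem).trans ?_
  have hdist : ∀ i, dist ((WithLp.toLp 2 e : EuclideanSpace ℝ ι) i)
      ((WithLp.toLp 2 fun i => min (e i) (errFloor N ρ i) : EuclideanSpace ℝ ι) i) =
      max 0 (e i - errFloor N ρ i) := by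
    intro i
    simp only [Real.dist_eq]
    rcases le_total (e i) (errFloor N ρ i) with h | h
    · rw [min_eq_left h, max_eq_left (by linarith)]
      simp
    · rw [min_eq_right h, max_eq_right (by linarith), abs_of_nonneg (by linarith)]
  rw [EuclideanSpace.dist_eq]
  simp_rw [hdist]
  refine Real.sqrt_le_iff.mpr ⟨Finset.sum_nonneg fun i _ => le_max_left _ _, ?_⟩
  exact Finset.sum_sq_le_sq_sum_of_nonneg fun i _ => le_max_left _ _

end NilpotentMatrix

/-! ### Powers of the edge matrix and paths in a forest. -/

section Graph

variable {V : Type*} [Fintype V] [DecidableEq V] {G : SimpleGraph V} [DecidableRel G.Adj]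

/-- In a graph without cycles, powers of a matrix supported on consecutive darts describe paths. -/
theorem exists_isPath_of_pow_apply_ne_zero (hG : G.IsAcyclic) {N : Matrix G.Dart G.Dart ℝ}
    (hN : ∀ d f, N d f ≠ 0 → f ∈ incoming G d) (ℓ : ℕ) (d f : G.Dart) (h : (N ^ ℓ) d f ≠ 0) :
    ∃ p : G.Walk f.fst d.fst, (p.concat d.adj).IsPath ∧ p.length = ℓ := by
  induction ℓ generalizing d with
  | zero =>
    obtain rfl : d = f := by
      by_contra hne
      exact h (by rw [pow_zero, one_apply_ne hne])
    exact ⟨.nil, by simp [SimpleGraph.Walk.concat, d.adj.ne], rfl⟩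
  | succ ℓ ih =>
    rw [pow_succ', mul_apply] at h
    obtain ⟨e, -, he⟩ := Finset.exists_ne_zero_of_sum_ne_zero h
    obtain ⟨p, hp, hlen⟩ := ih e (right_ne_zero_of_mul he)
    have hmem := hN d e (left_ne_zero_of_mul he)
    simp only [incoming, Finset.mem_filter, Finset.mem_univ, true_and] at hmem
    obtain ⟨hsnd, hne⟩ := hmem
    obtain ⟨⟨a, b⟩, hab⟩ := e
    obtain ⟨⟨b', c⟩, hbc⟩ := d
    simp only at hsnd hne p
    subst hsnd
    refine ⟨p.concat hab, ?_, by simp [hlen]⟩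
    -- In a forest a walk is a path once consecutive edges differ. Only the new junction has to be
    -- checked, and there `incoming` forbids turning back.
    rw [SimpleGraph.Walk.concat_eq_append, hG.isPath_iff_isChain]
    rw [hG.isPath_iff_isChain] at hp
    rw [SimpleGraph.Walk.edges_append, List.isChain_append]
    refine ⟨hp, by simp, ?_⟩
    simp only [SimpleGraph.Walk.concat_eq_append, SimpleGraph.Walk.edges_append,
      SimpleGraph.Walk.edges_cons, SimpleGraph.Walk.edges_nil, List.getLast?_append,
      List.getLast?_singleton, Option.some_or, Option.mem_def, Option.some.injEq, List.head?_cons]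
    rintro x rfl y rfl hxy
    rw [Sym2.eq_iff] at hxy
    rcases hxy with ⟨h1, -⟩ | ⟨h1, -⟩
    · exact hab.ne h1
    · exact hne h1

/-- A nonzero entry of N^ℓ gives a path with ℓ + 1 edges, because d itself is appended; hence the
exponent ℓ already suffices. -/
theorem pow_eq_zero_of_isAcyclic (hG : G.IsAcyclic) {N : Matrix G.Dart G.Dart ℝ}
    (hN : ∀ d f, N d f ≠ 0 → f ∈ incoming G d) (ℓ : ℕ)
    (hℓ : ∀ (u v : V) (p : G.Walk u v), p.IsPath → p.length ≤ ℓ) : N ^ ℓ = 0 := by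
  ext d f
  by_contra h
  obtain ⟨p, hp, hlen⟩ := exists_isPath_of_pow_apply_ne_zero hG hN ℓ d f h
  have := hℓ _ _ _ hp
  rw [SimpleGraph.Walk.length_concat] at this
  omega

theorem isNilpotent_of_isAcyclic (hG : G.IsAcyclic) {N : Matrix G.Dart G.Dart ℝ}
    (hN : ∀ d f, N d f ≠ 0 → f ∈ incoming G d) : IsNilpotent N :=
  ⟨Fintype.card V, pow_eq_zero_of_isAcyclic hG hN _ fun _ _ _ hp => hp.length_lt.le⟩

end Graph

/-! ### A strong law for bounded orthogonal sequences. -/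

section OrthogonalSequence

variable {Ω : Type*} [MeasurableSpace Ω] {P : Measure Ω} [IsProbabilityMeasure P]
  {ξ : ℕ → Ω → ℝ} {C : ℝ}

omit [IsProbabilityMeasure P] in
theorem memLp_top_sum_range (hξ : ∀ n, AEStronglyMeasurable (ξ n) P)
    (hC : ∀ n, ∀ᵐ ω ∂P, |ξ n ω| ≤ C) (t : ℕ) :
    MemLp (fun ω => ∑ s ∈ Finset.range t, ξ s ω) ⊤ P :=
  memLp_finsetSum _ fun n _ => memLp_top_of_bound (hξ n) C (by simpa using hC n)

theorem integrable_sq_sum_range (hξ : ∀ n, AEStronglyMeasurable (ξ n) P)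
    (hC : ∀ n, ∀ᵐ ω ∂P, |ξ n ω| ≤ C) (t : ℕ) :
    Integrable (fun ω => (∑ s ∈ Finset.range t, ξ s ω) ^ 2) P :=
  ((memLp_top_sum_range hξ hC t).mono_exponent le_top).integrable_sq

/-- Partial sums of bounded orthogonal random variables have second moment of linear growth. -/
theorem integral_sq_sum_range_le (hξ : ∀ n, AEStronglyMeasurable (ξ n) P)
    (hC : ∀ n, ∀ᵐ ω ∂P, |ξ n ω| ≤ C) (horth : ∀ i j, i < j → ∫ ω, ξ i ω * ξ j ω ∂P = 0) (t : ℕ) :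
    ∫ ω, (∑ s ∈ Finset.range t, ξ s ω) ^ 2 ∂P ≤ t * C ^ 2 := by
  induction t with
  | zero => simp
  | succ t ih =>
    have hL : ∀ n, MemLp (ξ n) 2 P := fun n =>
      (memLp_top_of_bound (hξ n) C (by simpa using hC n)).mono_exponent le_top
    have hprod : ∀ s, Integrable (fun ω => ξ s ω * ξ t ω) P := fun s =>
      (hL s).integrable_mul (hL t)
    have hcross : ∫ ω, 2 * (∑ s ∈ Finset.range t, ξ s ω * ξ t ω) ∂P = 0 := by
      rw [integral_const_mul, integral_finsetSum _ fun s _ => hprod s]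
      rw [Finset.sum_eq_zero fun s hs => horth s t (Finset.mem_range.mp hs), mul_zero]
    have hsq : ∫ ω, ξ t ω ^ 2 ∂P ≤ C ^ 2 := by
      calc ∫ ω, ξ t ω ^ 2 ∂P ≤ ∫ _ω, C ^ 2 ∂P := by
            refine integral_mono_ae (hL t).integrable_sq (integrable_const _) ?_
            filter_upwards [hC t] with ω hω
            exact sq_le_sq' (abs_le.mp hω).1 (abs_le.mp hω).2
        _ = C ^ 2 := by simp
    have hexp : ∀ ω, (∑ s ∈ Finset.range (t + 1), ξ s ω) ^ 2 =
        (∑ s ∈ Finset.range t, ξ s ω) ^ 2 + 2 * (∑ s ∈ Finset.range t, ξ s ω * ξ t ω) +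
          ξ t ω ^ 2 := fun ω => by
      rw [Finset.sum_range_succ, ← Finset.sum_mul]
      ring
    have hcint : Integrable (fun ω => 2 * (∑ s ∈ Finset.range t, ξ s ω * ξ t ω)) P :=
      (integrable_finsetSum _ fun s _ => hprod s).const_mul 2
    have hadd : Integrable (fun ω => (∑ s ∈ Finset.range t, ξ s ω) ^ 2 +
        2 * (∑ s ∈ Finset.range t, ξ s ω * ξ t ω)) P :=
      (integrable_sq_sum_range hξ hC t).add hcint
    simp_rw [hexp]
    rw [integral_add hadd (hL t).integrable_sq,
      integral_add (integrable_sq_sum_range hξ hC t) hcint, hcross]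
    push_cast
    linarith

/-- Between t and the largest square below it lie at most 2⌊√t⌋ terms, each bounded by C. -/
theorem abs_sum_range_le_sqrt {u : ℕ → ℝ} (hu : ∀ n, |u n| ≤ C) (t : ℕ) :
    |∑ s ∈ Finset.range t, u s| ≤ |∑ s ∈ Finset.range (t.sqrt ^ 2), u s| + 2 * t.sqrt * C := by
  have hC0 : 0 ≤ C := (abs_nonneg _).trans (hu 0)
  have h1 : t.sqrt ^ 2 ≤ t := Nat.sqrt_le' t
  have h2 : t - t.sqrt ^ 2 ≤ 2 * t.sqrt := by
    have := Nat.sqrt_le_add t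
    have e : t.sqrt ^ 2 = t.sqrt * t.sqrt := sq _
    omega
  rw [← Finset.sum_range_add_sum_Ico _ h1]
  refine (abs_add_le _ _).trans (add_le_add_right ?_ _)
  refine (Finset.abs_sum_le_sum_abs _ _).trans ((Finset.sum_le_sum fun s _ => hu s).trans ?_)
  rw [Finset.sum_const, Nat.card_Ico, nsmul_eq_mul]
  refine mul_le_mul_of_nonneg_right ?_ hC0
  exact_mod_cast h2

/-- Strong law of large numbers for bounded orthogonal random variables. -/
theorem ae_tendsto_average_of_orthogonal (hξ : ∀ n, AEStronglyMeasurable (ξ n) P)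
    (hC : ∀ n, ∀ᵐ ω ∂P, |ξ n ω| ≤ C) (horth : ∀ i j, i < j → ∫ ω, ξ i ω * ξ j ω ∂P = 0) :
    ∀ᵐ ω ∂P, Tendsto (fun t : ℕ => 1 / (t : ℝ) * ∑ s ∈ Finset.range t, ξ s ω) atTop (𝓝 0) := by
  -- Along squares the averages have second moment at most C²/n², which is summable. The sum of
  -- their squares is thus almost surely finite, so they tend to 0; the gaps between squares are
  -- filled deterministically.
  set f : ℕ → Ω → ℝ := fun n ω => (∑ s ∈ Finset.range (n ^ 2), ξ s ω) ^ 2 / ((n : ℝ) ^ 2) ^ 2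
    with hf
  have hf0 : ∀ n ω, 0 ≤ f n ω := fun n ω => by positivity
  have hfint : ∀ n, Integrable (f n) P := fun n => (integrable_sq_sum_range hξ hC _).div_const _
  have hbound : ∀ n, ∫ ω, f n ω ∂P ≤ C ^ 2 * (1 / (n : ℝ) ^ 2) := by
    intro n
    have h := integral_sq_sum_range_le hξ hC horth (n ^ 2)
    rw [hf, integral_div]
    rcases Nat.eq_zero_or_pos n with rfl | hn
    · simp
    · have hn' : (0 : ℝ) < n := by exact_mod_cast hn
      rw [div_le_iff₀ (by positivity)]
      push_cast at h
      refine h.trans (le_of_eq ?_)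
      field_simp
  have hsum : Summable fun n : ℕ => C ^ 2 * (1 / (n : ℝ) ^ 2) :=
    (Real.summable_one_div_nat_pow.mpr one_lt_two).mul_left _
  have htsum : ∑' n, ∫⁻ ω, ENNReal.ofReal (f n ω) ∂P ≠ ⊤ := by
    refine ne_top_of_le_ne_top hsum.tsum_ofReal_ne_top (ENNReal.tsum_le_tsum fun n => ?_)
    rw [← ofReal_integral_eq_lintegral_ofReal (hfint n) (ae_of_all _ (hf0 n))]
    exact ENNReal.ofReal_le_ofReal (hbound n)
  have hmeas : ∀ n, AEMeasurable (fun ω => ENNReal.ofReal (f n ω)) P := fun n =>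
    (hfint n).aemeasurable.ennreal_ofReal
  rw [← lintegral_tsum hmeas] at htsum
  have hae := ae_lt_top' (AEMeasurable.tsum hmeas) htsum
  filter_upwards [hae, ae_all_iff.mpr hC] with ω hω hCω
  have hfto : Tendsto (fun n => f n ω) atTop (𝓝 0) := by
    have h := ENNReal.tendsto_atTop_zero_of_tsum_ne_top hω.ne
    have := (ENNReal.tendsto_toReal ENNReal.zero_ne_top).comp h
    simpa [Function.comp_def, ENNReal.toReal_ofReal (hf0 _ ω)] using this
  have hsub : Tendsto (fun n : ℕ => |∑ s ∈ Finset.range (n ^ 2), ξ s ω| / (n : ℝ) ^ 2) atTop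
      (𝓝 0) := by
    have h := hfto.sqrt
    rw [Real.sqrt_zero] at h
    refine h.congr fun n => ?_
    simp only [hf]
    rw [← div_pow, Real.sqrt_sq_eq_abs, abs_div, abs_of_nonneg (sq_nonneg (n : ℝ))]
  have hsqrt : Tendsto Nat.sqrt atTop atTop :=
    tendsto_atTop_mono' atTop (Eventually.of_forall fun _ => le_rfl)
      (Filter.tendsto_atTop_atTop.mpr fun b => ⟨b ^ 2, fun a ha => Nat.le_sqrt'.mpr ha⟩)
  have hub : Tendsto (fun t : ℕ => |∑ s ∈ Finset.range (t.sqrt ^ 2), ξ s ω| / (t.sqrt : ℝ) ^ 2 +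
      2 * C / (t.sqrt : ℝ)) atTop (𝓝 0) := by
    have h1 := hsub.comp hsqrt
    have h2 := (tendsto_const_div_atTop_nhds_zero_nat (2 * C)).comp hsqrt
    simpa using h1.add h2
  refine squeeze_zero_norm' ?_ hub
  filter_upwards [eventually_ge_atTop 1] with t ht
  have hn : 1 ≤ t.sqrt := Nat.le_sqrt'.mpr (by simpa using ht)
  have hn' : (0 : ℝ) < t.sqrt := by exact_mod_cast hn
  have ht' : (0 : ℝ) < t := by exact_mod_cast ht
  have hle : (t.sqrt : ℝ) ^ 2 ≤ t := by exact_mod_cast Nat.sqrt_le' t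
  have hC0 : 0 ≤ C := (abs_nonneg _).trans (hCω 0)
  rw [Real.norm_eq_abs, abs_mul, abs_of_pos (by positivity : 0 < 1 / (t : ℝ)), one_div,
    inv_mul_eq_div]
  calc |∑ s ∈ Finset.range t, ξ s ω| / (t : ℝ)
      ≤ (|∑ s ∈ Finset.range (t.sqrt ^ 2), ξ s ω| + 2 * t.sqrt * C) / (t.sqrt : ℝ) ^ 2 := by
        gcongr
        exact abs_sum_range_le_sqrt hCω t
    _ = _ := by
        field_simp

end OrthogonalSequence

/-! ### Conditional expectations from conditional laws. -/

section ConditionalExpectation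

variable {Ω : Type*} {m mΩ : MeasurableSpace Ω} {P : Measure Ω} [IsProbabilityMeasure P]
  {X : Type*} [MeasurableSpace X]

/-- By the pull-out property a fluctuation about the conditional mean is orthogonal to every bounded
quantity known to the past. -/
theorem integral_mul_sub_condExp_eq_zero (hm : m ≤ mΩ) {W H : Ω → ℝ}
    (hW : StronglyMeasurable[m] W) {C : ℝ} (hC : ∀ᵐ ω ∂P, |W ω| ≤ C) (hH : Integrable H P) :
    ∫ ω, W ω * (H ω - (P[H | m]) ω) ∂P = 0 := by
  have hsub : Integrable (H - P[H | m]) P := hH.sub integrable_condExp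
  have h1 : P[W * (H - P[H | m]) | m] =ᵐ[P] W * P[H - P[H | m] | m] :=
    condExp_stronglyMeasurable_mul_of_bound hm hW hsub C (by simpa using hC)
  have h2 : P[H - P[H | m] | m] =ᵐ[P] 0 := by
    refine (condExp_sub hH integrable_condExp m).trans ?_
    filter_upwards [condExp_condExp_of_le (μ := P) (f := H) le_rfl hm] with ω hω
    simp [hω]
  calc ∫ ω, W ω * (H ω - (P[H | m]) ω) ∂P = ∫ ω, (P[W * (H - P[H | m]) | m]) ω ∂P :=
        (integral_condExp hm).symm
    _ = ∫ _ω, (0 : ℝ) ∂P := by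
        refine integral_congr_ae ?_
        filter_upwards [h1, h2] with ω hω1 hω2
        rw [hω1, Pi.mul_apply, hω2]
        simp
    _ = 0 := integral_zero _ _

theorem condExp_simpleFunc_comp_ae_eq_integral {Z : Ω → X} (hZ : Measurable Z)
    {κ : Ω → Measure X} [∀ ω, IsProbabilityMeasure (κ ω)]
    (h : ∀ B, MeasurableSet B →
      P[(Z ⁻¹' B).indicator (fun _ => (1 : ℝ)) | m] =ᵐ[P] fun ω => (κ ω).real B)
    (s : SimpleFunc X ℝ) :
    P[fun ω => s (Z ω) | m] =ᵐ[P] fun ω => ∫ x, s x ∂κ ω := by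
  induction s using SimpleFunc.induction with
  | @const c B hB =>
    have e : (fun ω => (SimpleFunc.piecewise B hB (SimpleFunc.const X c)
        (SimpleFunc.const X 0)) (Z ω)) = c • (Z ⁻¹' B).indicator (fun _ => (1 : ℝ)) := by
      ext ω
      by_cases hω : Z ω ∈ B <;> simp [hω]
    rw [e]
    refine (condExp_smul c _ m).trans ?_
    filter_upwards [h B hB] with ω hω
    rw [Pi.smul_apply, hω]
    simp only [SimpleFunc.coe_piecewise, SimpleFunc.coe_const, Function.const_zero,
      Set.piecewise_eq_indicator]
    rw [integral_indicator hB]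
    simp [mul_comm]
  | @add f g _ hf hg =>
    have hint : ∀ s : SimpleFunc X ℝ, Integrable (fun ω => s (Z ω)) P := fun s =>
      (s.comp Z hZ).integrable_of_isFiniteMeasure
    refine (condExp_add (hint f) (hint g) m).trans ?_
    filter_upwards [hf, hg] with ω h1 h2
    rw [Pi.add_apply, h1, h2]
    exact (integral_add f.integrable_of_isFiniteMeasure g.integrable_of_isFiniteMeasure).symm

/-- A family of probability measures which gives the conditional probabilities of all events about
`Z` also gives the conditional expectations of all bounded functions of `Z`. -/
theorem condExp_comp_ae_eq_integral (hm : m ≤ mΩ) {Z : Ω → X} (hZ : Measurable Z)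
    {κ : Ω → Measure X} [∀ ω, IsProbabilityMeasure (κ ω)]
    (h : ∀ B, MeasurableSet B →
      P[(Z ⁻¹' B).indicator (fun _ => (1 : ℝ)) | m] =ᵐ[P] fun ω => (κ ω).real B)
    {g : X → ℝ} (hg : Measurable g) {C : ℝ} (hC0 : 0 ≤ C) (hC : ∀ x, |g x| ≤ C) :
    P[fun ω => g (Z ω) | m] =ᵐ[P] fun ω => ∫ x, g x ∂κ ω := by
  have hgs := hg.stronglyMeasurable
  set s : ℕ → SimpleFunc X ℝ := fun n => hgs.approxBounded C n with hs
  have hsb : ∀ n x, ‖s n x‖ ≤ C := fun n x => hgs.norm_approxBounded_le hC0 n x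
  have hslim : ∀ x, Tendsto (fun n => s n x) atTop (𝓝 (g x)) := fun x =>
    hgs.tendsto_approxBounded_of_norm_le (by simpa using hC x)
  have hsim : ∀ n, P[fun ω => s n (Z ω) | m] =ᵐ[P] fun ω => ∫ x, s n x ∂κ ω := fun n =>
    condExp_simpleFunc_comp_ae_eq_integral hZ h (s n)
  have hκb : ∀ (f : X → ℝ), (∀ x, ‖f x‖ ≤ C) → ∀ ω, ‖∫ x, f x ∂κ ω‖ ≤ C := fun f hf ω => by
    simpa using norm_integral_le_of_norm_le_const (μ := κ ω) (ae_of_all _ hf)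
  have hlim : ∀ ω, Tendsto (fun n => ∫ x, s n x ∂κ ω) atTop (𝓝 (∫ x, g x ∂κ ω)) := fun ω =>
    tendsto_integral_of_dominated_convergence (fun _ => C)
      (fun n => (s n).aestronglyMeasurable) (integrable_const _)
      (fun n => ae_of_all _ (hsb n)) (ae_of_all _ hslim)
  have hgsm : ∀ n, AEStronglyMeasurable[m] (fun ω => ∫ x, s n x ∂κ ω) P := fun n =>
    ⟨_, stronglyMeasurable_condExp, (hsim n).symm⟩
  -- Measurability of ω ↦ κ ω is not assumed. It is recovered for this integral as an almost sure
  -- limit of conditional expectations.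
  have hG : AEStronglyMeasurable[m] (fun ω => ∫ x, g x ∂κ ω) P := by
    refine ⟨fun ω => limsup (fun n => (P[fun ω => s n (Z ω) | m]) ω) atTop,
      (Measurable.limsup fun n => stronglyMeasurable_condExp.measurable).stronglyMeasurable, ?_⟩
    filter_upwards [ae_all_iff.mpr hsim] with ω hω
    simp only [hω]
    exact (hlim ω).limsup_eq.symm
  have hGint : Integrable (fun ω => ∫ x, g x ∂κ ω) P :=
    Integrable.of_bound (hG.mono hm) C (ae_of_all _ (hκb g (by simpa using hC)))
  have hgsint : ∀ n, Integrable (fun ω => ∫ x, s n x ∂κ ω) P := fun n =>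
    integrable_condExp.congr (hsim n)
  refine (tendsto_condExp_unique (fun n ω => s n (Z ω)) (fun n ω => ∫ x, s n x ∂κ ω)
    (fun ω => g (Z ω)) (fun ω => ∫ x, g x ∂κ ω)
    (fun n => ((s n).comp Z hZ).integrable_of_isFiniteMeasure) hgsint
    (ae_of_all _ fun ω => hslim (Z ω)) (ae_of_all _ hlim) (fun _ => C) (integrable_const _)
    (fun _ => C) (integrable_const _) (fun n => ae_of_all _ fun ω => hsb n (Z ω))
    (fun n => ae_of_all _ (hκb _ (hsb n))) fun n => ?_).trans
    (condExp_of_aestronglyMeasurable' hm hG hGint)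
  exact (hsim n).trans (condExp_of_aestronglyMeasurable' hm (hgsm n) (hgsint n)).symm

end ConditionalExpectation

/-! ### Weighted averages and normalized densities. -/

section FiniteMeasure

variable {X : Type*} [MeasurableSpace X] {μ : Measure X}

theorem Integrable.mul_of_abs_le {f g : X → ℝ} (hf : Integrable f μ)
    (hg : AEStronglyMeasurable g μ) {B : ℝ} (hB : ∀ x, |g x| ≤ B) :
    Integrable (fun x => f x * g x) μ :=
  hf.mul_bdd hg (ae_of_all _ hB)

theorem abs_integral_le_of_abs_le {f g : X → ℝ} (hg : Integrable g μ) (h : ∀ x, |f x| ≤ g x) :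
    |∫ x, f x ∂μ| ≤ ∫ x, g x ∂μ := by
  rw [← Real.norm_eq_abs]
  exact norm_integral_le_of_norm_le hg (ae_of_all _ h)

/-- Weighted averages of a bounded function depend on the weight in a Lipschitz way. -/
theorem abs_weighted_average_sub_le {f f' g : X → ℝ} (hf : ∀ x, 0 ≤ f x)
    (hfi : Integrable f μ) (hfi' : Integrable f' μ) (hZ : 0 < ∫ x, f x ∂μ)
    (hZ' : 0 < ∫ x, f' x ∂μ) (hg : AEStronglyMeasurable g μ) {B : ℝ} (hB0 : 0 ≤ B)
    (hB : ∀ x, |g x| ≤ B) :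
    |(∫ x, f x * g x ∂μ) / (∫ x, f x ∂μ) - (∫ x, f' x * g x ∂μ) / ∫ x, f' x ∂μ| ≤
      2 * B * (∫ x, |f x - f' x| ∂μ) / ∫ x, f' x ∂μ := by
  have hfg := Integrable.mul_of_abs_le hfi hg hB
  have hfg' := Integrable.mul_of_abs_le hfi' hg hB
  set D := ∫ x, |f x - f' x| ∂μ with hD
  set Z := ∫ x, f x ∂μ with hZdef
  set Z' := ∫ x, f' x ∂μ with hZdef'
  have hdiff : Integrable (fun x => |f x - f' x|) μ := (hfi.sub hfi').abs
  have h1 : |(∫ x, f x * g x ∂μ) - ∫ x, f' x * g x ∂μ| ≤ B * D := by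
    rw [← integral_sub hfg hfg', hD, ← integral_const_mul]
    refine abs_integral_le_of_abs_le (hdiff.const_mul B) fun x => ?_
    rw [← sub_mul, abs_mul, mul_comm]
    exact mul_le_mul_of_nonneg_right (hB x) (abs_nonneg _)
  have h2 : |Z' - Z| ≤ D := by
    rw [hZdef, hZdef', ← integral_sub hfi' hfi, hD]
    refine abs_integral_le_of_abs_le hdiff fun x => ?_
    exact (abs_sub_comm _ _).le
  have h3 : |∫ x, f x * g x ∂μ| ≤ B * Z := by
    rw [hZdef, ← integral_const_mul]
    refine abs_integral_le_of_abs_le (hfi.const_mul B) fun x => ?_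
    rw [abs_mul, abs_of_nonneg (hf x), mul_comm]
    exact mul_le_mul_of_nonneg_right (hB x) (hf x)
  -- Here 1/Z occurs only inside an average bounded by B. The estimate therefore needs no lower
  -- bound on the mass of f, which will be the random weight.
  have h4 : (∫ x, f x * g x ∂μ) / Z - (∫ x, f' x * g x ∂μ) / Z' =
      (((∫ x, f x * g x ∂μ) - ∫ x, f' x * g x ∂μ) + (∫ x, f x * g x ∂μ) / Z * (Z' - Z)) / Z' := by
    field_simp
    ring
  have h5 : |(∫ x, f x * g x ∂μ) / Z| ≤ B := by
    rw [abs_div, abs_of_pos hZ, div_le_iff₀ hZ]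
    exact h3
  rw [h4, abs_div, abs_of_pos hZ']
  refine div_le_div_of_nonneg_right ?_ hZ'.le
  calc _ ≤ |(∫ x, f x * g x ∂μ) - ∫ x, f' x * g x ∂μ| + |(∫ x, f x * g x ∂μ) / Z * (Z' - Z)| :=
        abs_add_le _ _
    _ ≤ B * D + B * D := by
        rw [abs_mul]
        exact add_le_add h1 (mul_le_mul h5 h2 (abs_nonneg _) hB0)
    _ = 2 * B * D := by ring

theorem abs_weighted_average_le {f g : X → ℝ} (hf : ∀ x, 0 ≤ f x)
    (hfi : Integrable f μ) (hZ : 0 < ∫ x, f x ∂μ) {B : ℝ} (hB : ∀ x, |g x| ≤ B) :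
    |(∫ x, f x * g x ∂μ) / ∫ x, f x ∂μ| ≤ B := by
  rw [abs_div, abs_of_pos hZ, div_le_iff₀ hZ, ← integral_const_mul]
  refine abs_integral_le_of_abs_le (hfi.const_mul B) fun x => ?_
  rw [abs_mul, abs_of_nonneg (hf x), mul_comm]
  exact mul_le_mul_of_nonneg_right (hB x) (hf x)

theorem withDensity_ofReal_univ {f : X → ℝ} (hf : ∀ x, 0 ≤ f x) (hfi : Integrable f μ) :
    (μ.withDensity fun x => ENNReal.ofReal (f x)) Set.univ = ENNReal.ofReal (∫ x, f x ∂μ) := by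
  rw [withDensity_apply _ MeasurableSet.univ, Measure.restrict_univ,
    ofReal_integral_eq_lintegral_ofReal hfi (ae_of_all _ hf)]

theorem isProbabilityMeasure_normalizedMeasure {f : X → ℝ} (hf : ∀ x, 0 ≤ f x)
    (hfi : Integrable f μ) (hZ : 0 < ∫ x, f x ∂μ) :
    IsProbabilityMeasure (normalizedMeasure μ f) := by
  refine ⟨?_⟩
  rw [normalizedMeasure, Measure.smul_apply, withDensity_ofReal_univ hf hfi, smul_eq_mul]
  exact ENNReal.inv_mul_cancel (by simpa using hZ) ENNReal.ofReal_ne_top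

theorem integral_normalizedMeasure {f : X → ℝ} (hf : ∀ x, 0 ≤ f x) (hfm : Measurable f)
    (hfi : Integrable f μ) (g : X → ℝ) :
    ∫ x, g x ∂(normalizedMeasure μ f) = (∫ x, f x * g x ∂μ) / ∫ x, f x ∂μ := by
  rw [normalizedMeasure, integral_smul_measure, withDensity_ofReal_univ hf hfi,
    integral_withDensity_eq_integral_toReal_smul hfm.ennreal_ofReal
      (ae_of_all _ fun x => ENNReal.ofReal_lt_top), ENNReal.toReal_inv,
    ENNReal.toReal_ofReal (integral_nonneg hf), smul_eq_mul, inv_mul_eq_div]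
  simp_rw [ENNReal.toReal_ofReal (hf _), smul_eq_mul]

/-- Cauchy–Schwarz against the constant 1, read off the discriminant of c ↦ ∫ (c|h| - 1)². -/
theorem sq_integral_abs_le [IsFiniteMeasure μ] {h : X → ℝ} (hh : MemLp h 2 μ) :
    (∫ x, |h x| ∂μ) ^ 2 ≤ μ.real Set.univ * ∫ x, h x ^ 2 ∂μ := by
  have hint : Integrable (fun x => |h x|) μ := (hh.integrable one_le_two).abs
  have hsq : Integrable (fun x => h x ^ 2) μ := hh.integrable_sq
  have key : ∀ c : ℝ, 0 ≤ (∫ x, h x ^ 2 ∂μ) * (c * c) + (-2 * ∫ x, |h x| ∂μ) * c +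
      μ.real Set.univ := by
    intro c
    have h1 : 0 ≤ ∫ x, (h x ^ 2 * (c * c) + (-2 * c) * |h x| + 1) ∂μ := by
      refine integral_nonneg fun x => ?_
      have : h x ^ 2 * (c * c) + (-2 * c) * |h x| + 1 = (c * |h x| - 1) ^ 2 := by
        rw [← sq_abs (h x)]
        ring
      simp only [Pi.zero_apply, this]
      positivity
    have h2 : Integrable (fun x => h x ^ 2 * (c * c) + (-2 * c) * |h x|) μ :=
      (hsq.mul_const _).add (hint.const_mul _)
    rw [integral_add h2 (integrable_const _), integral_add (hsq.mul_const _) (hint.const_mul _),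
      integral_mul_const, integral_const_mul, integral_const, smul_eq_mul, mul_one] at h1
    linarith
  have := discrim_le_zero key
  rw [discrim] at this
  linarith

/-- Factors are exchanged one at a time, the others being at most C; C ≥ 1 allows one common power.
-/
theorem abs_prod_sub_prod_le {ι : Type*} (s : Finset ι) {a b : ι → ℝ} {C : ℝ} (hC : 1 ≤ C)
    (ha0 : ∀ i, 0 ≤ a i) (hb0 : ∀ i, 0 ≤ b i) (ha : ∀ i, a i ≤ C) (hb : ∀ i, b i ≤ C) :
    |∏ i ∈ s, a i - ∏ i ∈ s, b i| ≤ C ^ s.card * ∑ i ∈ s, |a i - b i| := by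
  classical
  induction s using Finset.induction_on with
  | empty => simp
  | insert i s hi ih =>
    rw [Finset.prod_insert hi, Finset.prod_insert hi, Finset.sum_insert hi,
      Finset.card_insert_of_notMem hi]
    have hprod : ∏ j ∈ s, a j ≤ C ^ s.card := by
      rw [← Finset.prod_const]
      exact Finset.prod_le_prod (fun j _ => ha0 j) fun j _ => ha j
    have hprod0 : 0 ≤ ∏ j ∈ s, a j := Finset.prod_nonneg fun j _ => ha0 j
    have hpow : C ^ s.card ≤ C ^ (s.card + 1) := pow_le_pow_right₀ hC (Nat.le_succ _)
    calc |a i * ∏ j ∈ s, a j - b i * ∏ j ∈ s, b j|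
        = |(a i - b i) * ∏ j ∈ s, a j + b i * (∏ j ∈ s, a j - ∏ j ∈ s, b j)| := by
          congr 1
          ring
      _ ≤ |a i - b i| * ∏ j ∈ s, a j + b i * |∏ j ∈ s, a j - ∏ j ∈ s, b j| := by
          refine (abs_add_le _ _).trans ?_
          rw [abs_mul, abs_mul, abs_of_nonneg hprod0, abs_of_nonneg (hb0 i)]
      _ ≤ |a i - b i| * C ^ (s.card + 1) + C * (C ^ s.card * ∑ j ∈ s, |a j - b j|) :=
          add_le_add (mul_le_mul_of_nonneg_left (hprod.trans hpow) (abs_nonneg _))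
            (mul_le_mul (hb i) ih (abs_nonneg _) (by linarith))
      _ = C ^ (s.card + 1) * (|a i - b i| + ∑ j ∈ s, |a j - b j|) := by ring

end FiniteMeasure

/-! ### Truncated orthonormal expansions. -/

section OrthonormalBasis

variable {X : Type*} [MeasurableSpace X] {μ : Measure X} {φ : ℕ → X → ℝ}

namespace IsOrthonormalBasisL2

theorem memLp (hφ : IsOrthonormalBasisL2 μ φ) (j : ℕ) : MemLp (φ j) 2 μ := by
  obtain ⟨-, b, hb⟩ := hφ
  exact (memLp_congr_ae (hb j)).mp (Lp.memLp _)

theorem integral_mul_eq (hφ : IsOrthonormalBasisL2 μ φ) (i j : ℕ) :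
    ∫ x, φ i x * φ j x ∂μ = if i = j then 1 else 0 := by
  obtain ⟨-, b, hb⟩ := hφ
  rw [← orthonormal_iff_ite.mp b.orthonormal i j, L2.inner_def]
  refine integral_congr_ae ?_
  filter_upwards [hb i, hb j] with x hi hj
  rw [hi, hj]
  simp [mul_comm]

theorem measure_ne_zero (hφ : IsOrthonormalBasisL2 μ φ) : μ ≠ 0 := by
  rintro rfl
  have := hφ.integral_mul_eq 0 0
  simp at this

variable {r : ℕ}

theorem memLp_expansion (hφ : IsOrthonormalBasisL2 μ φ) (a : Fin r → ℝ) :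
    MemLp (expansion φ a) 2 μ :=
  memLp_finsetSum _ fun j _ => (hφ.memLp j).const_mul (a j)

theorem basisCoef_expansion (hφ : IsOrthonormalBasisL2 μ φ) (a : Fin r → ℝ) (j : Fin r) :
    basisCoef μ φ (expansion φ a) j = a j := by
  have hint : ∀ i : Fin r, Integrable (fun x => φ i x * φ j x) μ := fun i =>
    (hφ.memLp i).integrable_mul (hφ.memLp j)
  have h : ∀ x, expansion φ a x * φ j x = ∑ i : Fin r, a i * (φ i x * φ j x) := fun x => by
    rw [expansion, Finset.sum_mul]
    exact Finset.sum_congr rfl fun i _ => mul_assoc _ _ _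
  rw [basisCoef]
  simp_rw [h]
  rw [integral_finsetSum _ fun i _ => (hint i).const_mul (a i)]
  simp_rw [integral_const_mul, hφ.integral_mul_eq, Fin.val_inj]
  simp

theorem integral_expansion_mul (hφ : IsOrthonormalBasisL2 μ φ) {f : X → ℝ} (hf : MemLp f 2 μ)
    (a : Fin r → ℝ) :
    ∫ x, expansion φ a x * f x ∂μ = ∑ j, a j * basisCoef μ φ f j := by
  have hint : ∀ i : Fin r, Integrable (fun x => f x * φ i x) μ := fun i =>
    hf.integrable_mul (hφ.memLp i)
  have h : ∀ x, expansion φ a x * f x = ∑ i : Fin r, a i * (f x * φ i x) := fun x => by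
    rw [expansion, Finset.sum_mul]
    exact Finset.sum_congr rfl fun i _ => by ring
  simp_rw [h]
  rw [integral_finsetSum _ fun i _ => (hint i).const_mul (a i)]
  simp_rw [integral_const_mul, basisCoef]

theorem normSqL2_expansion (hφ : IsOrthonormalBasisL2 μ φ) (a : Fin r → ℝ) :
    normSqL2 μ (expansion φ a) = ∑ j, a j ^ 2 := by
  simp_rw [normSqL2, sq, hφ.integral_expansion_mul (hφ.memLp_expansion a) a,
    hφ.basisCoef_expansion]

theorem normSqL2_expansion_sub_projBasis (hφ : IsOrthonormalBasisL2 μ φ) (a : Fin r → ℝ)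
    (f : X → ℝ) :
    normSqL2 μ (fun x => expansion φ a x - projBasis μ φ r f x) =
      ∑ j : Fin r, (a j - basisCoef μ φ f j) ^ 2 := by
  rw [← hφ.normSqL2_expansion]
  congr 1
  ext x
  simp only [projBasis, expansion, ← Finset.sum_sub_distrib, sub_mul]

/-- The residual is orthogonal to the span, which kills the cross term in Pythagoras. -/
theorem basisCoef_sub_projBasis (hφ : IsOrthonormalBasisL2 μ φ) {f : X → ℝ} (hf : MemLp f 2 μ)
    (j : Fin r) : basisCoef μ φ (fun x => f x - projBasis μ φ r f x) j = 0 := by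
  simp only [basisCoef, sub_mul]
  have h : Integrable (fun x => projBasis μ φ r f x * φ j x) μ :=
    (hφ.memLp_expansion _).integrable_mul (hφ.memLp j)
  have h' : Integrable (fun x => f x * φ j x) μ := hf.integrable_mul (hφ.memLp j)
  rw [integral_sub h' h]
  have := hφ.basisCoef_expansion (fun j : Fin r => basisCoef μ φ f j) j
  simp only [basisCoef] at this
  simp only [projBasis, basisCoef, this, sub_self]

/-- Pythagoras for the distance of a function to an element of the span of the first `r` basis
functions. -/
theorem normSqL2_expansion_sub (hφ : IsOrthonormalBasisL2 μ φ) {f : X → ℝ} (hf : MemLp f 2 μ)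
    (a : Fin r → ℝ) :
    normSqL2 μ (fun x => expansion φ a x - f x) =
      normSqL2 μ (fun x => expansion φ a x - projBasis μ φ r f x) +
        normSqL2 μ (fun x => f x - projBasis μ φ r f x) := by
  set p := projBasis μ φ r f with hp
  have hpL : MemLp p 2 μ := hφ.memLp_expansion _
  have hAL : MemLp (fun x => f x - p x) 2 μ := hf.sub hpL
  set c : Fin r → ℝ := fun j => a j - basisCoef μ φ f j with hc
  have hD : ∀ x, expansion φ a x - p x = expansion φ c x := fun x => by
    simp only [hp, hc, projBasis, expansion, ← Finset.sum_sub_distrib, sub_mul]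
  have hcross : ∫ x, expansion φ c x * (f x - p x) ∂μ = 0 := by
    rw [hφ.integral_expansion_mul hAL]
    exact Finset.sum_eq_zero fun j _ => by rw [hφ.basisCoef_sub_projBasis hf, mul_zero]
  have hexp : ∀ x, (expansion φ a x - f x) ^ 2 = expansion φ c x ^ 2 + (f x - p x) ^ 2 -
      2 * (expansion φ c x * (f x - p x)) := fun x => by
    rw [← hD]
    ring
  have h1 : Integrable (fun x => expansion φ c x ^ 2) μ := (hφ.memLp_expansion c).integrable_sq
  have h2 : Integrable (fun x => (f x - p x) ^ 2) μ := hAL.integrable_sq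
  have h3 : Integrable (fun x => expansion φ c x * (f x - p x)) μ :=
    (hφ.memLp_expansion c).integrable_mul hAL
  have h12 : Integrable (fun x => expansion φ c x ^ 2 + (f x - p x) ^ 2) μ := h1.add h2
  simp_rw [normSqL2, hexp, hD]
  rw [integral_sub h12 (h3.const_mul 2), integral_add h1 h2, integral_const_mul, hcross]
  ring

end IsOrthonormalBasisL2

end OrthonormalBasis

/-! ### Bounded kernels, belief propagation updates and the fixed point. -/

noncomputable section

theorem measureReal_univ_pos_of_ne_zero {X : Type*} [MeasurableSpace X] {μ : Measure X}
    [IsFiniteMeasure μ] (hμ : μ ≠ 0) : 0 < μ.real Set.univ :=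
  haveI : NeZero μ := ⟨hμ⟩
  measureReal_univ_pos

/-- A measurable kernel with values between two positive constants. -/
structure IsBoundedKernel {X : Type*} [MeasurableSpace X] (K : X → X → ℝ) (c₁ c₂ : ℝ) : Prop where
  measurable : Measurable (Function.uncurry K)
  pos : 0 < c₁
  lower : ∀ x y, c₁ ≤ K x y
  upper : ∀ x y, K x y ≤ c₂

namespace IsBoundedKernel

variable {X : Type*} [MeasurableSpace X] {μ : Measure X} [IsFiniteMeasure μ]
  {K : X → X → ℝ} {c₁ c₂ : ℝ}

theorem abs_le (hK : IsBoundedKernel K c₁ c₂) (x y : X) : |K x y| ≤ c₂ := by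
  rw [abs_of_pos (hK.pos.trans_le (hK.lower x y))]
  exact hK.upper x y

omit [IsFiniteMeasure μ] in
theorem integrable_mul_left (hK : IsBoundedKernel K c₁ c₂) {f : X → ℝ} (hf : Integrable f μ)
    (y : X) : Integrable (fun x => K x y * f x) μ := by
  have h := Integrable.mul_of_abs_le hf
    (hK.measurable.comp (measurable_id.prodMk measurable_const)).aestronglyMeasurable
    (fun x => hK.abs_le x y)
  exact h.congr (ae_of_all _ fun x => mul_comm _ _)

omit [IsFiniteMeasure μ] in
theorem integrable_mul_right (hK : IsBoundedKernel K c₁ c₂) {w : X → ℝ} (hw : Integrable w μ)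
    (x : X) : Integrable (fun y => K x y * w y) μ := by
  have h := Integrable.mul_of_abs_le hw
    (hK.measurable.comp (measurable_const.prodMk measurable_id)).aestronglyMeasurable
    (fun y => hK.abs_le x y)
  exact h.congr (ae_of_all _ fun x => mul_comm _ _)

theorem measurable_integral_mul (hK : IsBoundedKernel K c₁ c₂) {f : X → ℝ} (hf : Measurable f) :
    Measurable fun y => ∫ x, K x y * f x ∂μ := by
  have h : Measurable (Function.uncurry fun y x => K x y * f x) :=
    (hK.measurable.comp measurable_swap).mul (hf.comp measurable_snd)
  exact h.stronglyMeasurable.integral_prod_right.measurable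

theorem measurable_integral (hK : IsBoundedKernel K c₁ c₂) : Measurable fun y => ∫ x, K x y ∂μ := by
  simpa using hK.measurable_integral_mul (μ := μ) (f := fun _ => 1) measurable_const

theorem le_integral (hK : IsBoundedKernel K c₁ c₂) (y : X) :
    c₁ * μ.real Set.univ ≤ ∫ x, K x y ∂μ := by
  have h := integral_mono (integrable_const c₁)
    (by simpa using hK.integrable_mul_left (integrable_const (μ := μ) (1 : ℝ)) y)
    (fun x => hK.lower x y)
  simpa [mul_comm] using h

theorem integral_le (hK : IsBoundedKernel K c₁ c₂) (y : X) :
    ∫ x, K x y ∂μ ≤ c₂ * μ.real Set.univ := by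
  have h := integral_mono
    (by simpa using hK.integrable_mul_left (integrable_const (μ := μ) (1 : ℝ)) y)
    (integrable_const c₂) (fun x => hK.upper x y)
  simpa [mul_comm] using h

theorem integral_pos (hK : IsBoundedKernel K c₁ c₂) (hμ : μ ≠ 0) (y : X) : 0 < ∫ x, K x y ∂μ :=
  (mul_pos hK.pos (measureReal_univ_pos_of_ne_zero hμ)).trans_le (hK.le_integral y)

theorem abs_integral_mul_div_le (hK : IsBoundedKernel K c₁ c₂) (hμ : μ ≠ 0) {f : X → ℝ}
    (hf : Integrable f μ) (y : X) :
    |(∫ x, K x y * f x ∂μ) / ∫ x, K x y ∂μ| ≤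
      (c₂ * ∫ x, |f x| ∂μ) / (c₁ * μ.real Set.univ) := by
  have hpos : 0 < c₁ * μ.real Set.univ := mul_pos hK.pos (measureReal_univ_pos_of_ne_zero hμ)
  rw [abs_div, abs_of_pos (hK.integral_pos hμ y)]
  refine div_le_div₀ (mul_nonneg ((abs_nonneg _).trans (hK.abs_le y y))
    (integral_nonneg fun _ => abs_nonneg _)) ?_ hpos (hK.le_integral y)
  rw [← integral_const_mul]
  refine abs_integral_le_of_abs_le (hf.abs.const_mul _) fun x => ?_
  rw [abs_mul]
  exact mul_le_mul_of_nonneg_right (hK.abs_le x y) (abs_nonneg _)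

/-- Fubini applies because a bounded kernel times f(x)w(y) is integrable on the product. -/
theorem integral_integral_mul_mul (hK : IsBoundedKernel K c₁ c₂) {w f : X → ℝ}
    (hw : Integrable w μ) (hf : Integrable f μ) :
    ∫ x, (∫ y, K x y * w y ∂μ) * f x ∂μ = ∫ y, w y * (∫ x, K x y * f x ∂μ) ∂μ := by
  have hint : Integrable (Function.uncurry fun x y => K x y * w y * f x) (μ.prod μ) := by
    have h := (hf.mul_prod hw).bdd_mul (c := c₂) hK.measurable.aestronglyMeasurable
      (ae_of_all _ fun p => hK.abs_le p.1 p.2)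
    refine h.congr (ae_of_all _ fun p => ?_)
    simp only [Function.uncurry]
    ring
  simp_rw [← integral_mul_const, ← integral_const_mul]
  rw [integral_integral_swap hint]
  refine integral_congr_ae (ae_of_all _ fun y => integral_congr_ae (ae_of_all _ fun x => ?_))
  simp only
  ring

section Update

variable {w m : X → ℝ}

omit [IsFiniteMeasure μ] in
/-- If normalizing the image of a nonnegative weight under the kernel gives a density, then the
weight is integrable (otherwise the image would be identically zero). -/
theorem integrable_of_update (hK : IsBoundedKernel K c₁ c₂) (hw0 : ∀ y, 0 ≤ w y)
    (hw : AEStronglyMeasurable w μ)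
    (hm : ∀ x, m x = (∫ y, K x y * w y ∂μ) / ∫ x', ∫ y, K x' y * w y ∂μ ∂μ)
    (hm1 : ∫ x, m x ∂μ = 1) : Integrable w μ := by
  by_contra hcon
  have hzero : ∀ x, ∫ y, K x y * w y ∂μ = 0 := by
    intro x
    refine integral_undef fun hint => hcon ?_
    refine (hint.const_mul c₁⁻¹).mono' hw (ae_of_all _ fun y => ?_)
    rw [Real.norm_of_nonneg (hw0 y), inv_mul_eq_div, le_div_iff₀ hK.pos, mul_comm]
    exact mul_le_mul_of_nonneg_right (hK.lower x y) (hw0 y)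
  simp [hm, hzero] at hm1

omit [IsFiniteMeasure μ] in
-- A weight of mass zero has image zero; then m = 0/0 = 0 by convention, which contradicts ∫ m = 1.
theorem integral_pos_of_update (hK : IsBoundedKernel K c₁ c₂) (hw0 : ∀ y, 0 ≤ w y)
    (hw : AEStronglyMeasurable w μ)
    (hm : ∀ x, m x = (∫ y, K x y * w y ∂μ) / ∫ x', ∫ y, K x' y * w y ∂μ ∂μ)
    (hm1 : ∫ x, m x ∂μ = 1) : 0 < ∫ y, w y ∂μ := by
  have hwi := hK.integrable_of_update hw0 hw hm hm1
  refine (integral_nonneg hw0).lt_of_ne fun h => ?_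
  have hae := (integral_eq_zero_iff_of_nonneg hw0 hwi).mp h.symm
  have hzero : ∀ x, ∫ y, K x y * w y ∂μ = 0 := by
    intro x
    rw [← integral_zero X ℝ (μ := μ)]
    refine integral_congr_ae ?_
    filter_upwards [hae] with y hy
    rw [hy]
    simp
  simp [hm, hzero] at hm1

omit [IsFiniteMeasure μ] in
theorem integral_mul_le_const_mul (hK : IsBoundedKernel K c₁ c₂) (hw0 : ∀ y, 0 ≤ w y)
    (hw : Integrable w μ) (x : X) : ∫ y, K x y * w y ∂μ ≤ c₂ * ∫ y, w y ∂μ := by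
  rw [← integral_const_mul]
  exact integral_mono (hK.integrable_mul_right hw x) (hw.const_mul _) fun y =>
    mul_le_mul_of_nonneg_right (hK.upper x y) (hw0 y)

theorem integral_integral_mul (hK : IsBoundedKernel K c₁ c₂) (hw : Integrable w μ) :
    ∫ x, ∫ y, K x y * w y ∂μ ∂μ = ∫ y, (∫ x, K x y ∂μ) * w y ∂μ := by
  have h := hK.integral_integral_mul_mul hw (integrable_const (1 : ℝ))
  simp only [mul_one] at h
  simp_rw [h, mul_comm]

/-- By Fubini the normalizing constant is at least c₁ μ(X) ∫ w, so ∫ w cancels and the bound does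
not depend on the incoming messages. -/
theorem update_le (hK : IsBoundedKernel K c₁ c₂) (hμ : μ ≠ 0) (hw0 : ∀ y, 0 ≤ w y)
    (hw : AEStronglyMeasurable w μ)
    (hm : ∀ x, m x = (∫ y, K x y * w y ∂μ) / ∫ x', ∫ y, K x' y * w y ∂μ ∂μ)
    (hm1 : ∫ x, m x ∂μ = 1) (x : X) :
    m x ≤ c₂ / (c₁ * μ.real Set.univ) := by
  have hwi := hK.integrable_of_update hw0 hw hm hm1
  have hp := hK.integral_pos_of_update hw0 hw hm hm1
  have hμ0 : 0 < μ.real Set.univ := measureReal_univ_pos_of_ne_zero hμ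
  have hc₁ := hK.pos
  have hc₂ : 0 < c₂ := hc₁.trans_le ((hK.lower x x).trans (hK.upper x x))
  have hup := hK.integral_mul_le_const_mul hw0 hwi x
  have hβw : Integrable (fun y => (∫ x, K x y ∂μ) * w y) μ :=
    hwi.bdd_mul (c := c₂ * μ.real Set.univ) hK.measurable_integral.aestronglyMeasurable
      (ae_of_all _ fun y => by
        rw [Real.norm_of_nonneg (hK.integral_pos hμ y).le]
        exact hK.integral_le y)
  have hZlow : c₁ * μ.real Set.univ * ∫ y, w y ∂μ ≤ ∫ y, (∫ x, K x y ∂μ) * w y ∂μ := by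
    rw [← integral_const_mul]
    exact integral_mono (hwi.const_mul _) hβw fun y =>
      mul_le_mul_of_nonneg_right (hK.le_integral y) (hw0 y)
  rw [hm, hK.integral_integral_mul hwi]
  calc _ ≤ (c₂ * ∫ y, w y ∂μ) / (c₁ * μ.real Set.univ * ∫ y, w y ∂μ) :=
        div_le_div₀ (by positivity) hup (by positivity) hZlow
    _ = _ := by
        field_simp

/-- Multiplying and dividing by ∫ K(x, y) μ(dx), which is β(y) in the application, exhibits a
coefficient of m as a weighted average of coefficients of the normalized kernel. -/
theorem integral_update_mul (hK : IsBoundedKernel K c₁ c₂) (hμ : μ ≠ 0) (hw0 : ∀ y, 0 ≤ w y)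
    (hw : AEStronglyMeasurable w μ)
    (hm : ∀ x, m x = (∫ y, K x y * w y ∂μ) / ∫ x', ∫ y, K x' y * w y ∂μ ∂μ)
    (hm1 : ∫ x, m x ∂μ = 1) {f : X → ℝ} (hf : Integrable f μ) :
    ∫ x, m x * f x ∂μ =
      (∫ y, ((∫ x, K x y ∂μ) * w y) * ((∫ x, K x y * f x ∂μ) / ∫ x, K x y ∂μ) ∂μ) /
        ∫ y, (∫ x, K x y ∂μ) * w y ∂μ := by
  have hwi := hK.integrable_of_update hw0 hw hm hm1
  have h : ∀ y, ((∫ x, K x y ∂μ) * w y) * ((∫ x, K x y * f x ∂μ) / ∫ x, K x y ∂μ) =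
      w y * ∫ x, K x y * f x ∂μ := fun y => by
    have := (hK.integral_pos hμ y).ne'
    field_simp
  simp_rw [h]
  rw [← hK.integral_integral_mul_mul hwi hf, ← hK.integral_integral_mul hwi, ← integral_div]
  refine integral_congr_ae (ae_of_all _ fun x => ?_)
  simp only
  rw [hm x]
  ring

end Update

end IsBoundedKernel

namespace PairwiseMRF

variable {V : Type*} [Fintype V] [DecidableEq V] {G : SimpleGraph V} [DecidableRel G.Adj]
  {X : Type*} [MeasurableSpace X] (M : PairwiseMRF G X) (μ : Measure X) (φ : ℕ → X → ℝ)

/-- The kernel `ψ_{uv}(x, y) ψ_v(y)` of the belief propagation update on `d = (v → u)`. -/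
def updateKernel (d : G.Dart) (x y : X) : ℝ :=
  M.edgePot d.snd d.fst x y * M.nodePot d.fst y

/-- All the update kernels are measurable and bounded between positive constants. -/
def HasBoundedKernels : Prop :=
  ∀ d, ∃ c₁ c₂, IsBoundedKernel (M.updateKernel d) c₁ c₂

omit [Fintype V] [DecidableEq V] [DecidableRel G.Adj] in
-- A continuous positive kernel on a nonempty compact space attains a positive minimum and a
-- maximum.
theorem hasBoundedKernels [TopologicalSpace X] [CompactSpace X] [SecondCountableTopology X]
    [BorelSpace X] (hnode : ∀ v, Continuous (M.nodePot v))
    (hedge : ∀ u v, G.Adj u v → Continuous fun p : X × X => M.edgePot u v p.1 p.2) :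
    M.HasBoundedKernels := by
  intro d
  have hcont : Continuous (Function.uncurry (M.updateKernel d)) :=
    (hedge _ _ d.adj.symm).mul ((hnode d.fst).comp continuous_snd)
  have hpos : ∀ p, 0 < Function.uncurry (M.updateKernel d) p := fun p =>
    mul_pos (M.edgePot_pos _ _ d.adj.symm _ _) (M.nodePot_pos _ _)
  rcases isEmpty_or_nonempty X with hX | hX
  · exact ⟨1, 1, hcont.measurable, one_pos, fun x => hX.elim x, fun x => hX.elim x⟩
  · obtain ⟨p, -, hp⟩ := isCompact_univ.exists_isMinOn Set.univ_nonempty hcont.continuousOn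
    obtain ⟨q, -, hq⟩ := isCompact_univ.exists_isMaxOn Set.univ_nonempty hcont.continuousOn
    exact ⟨_, _, hcont.measurable, hpos p, fun x y => hp (Set.mem_univ (x, y)),
      fun x y => hq (Set.mem_univ (x, y))⟩

omit [Fintype V] [DecidableEq V] [DecidableRel G.Adj] in
theorem beta_eq_integral (d : G.Dart) (y : X) :
    M.beta μ d y = ∫ x, M.updateKernel d x y ∂μ := by
  simp_rw [beta, updateKernel, integral_mul_const, mul_comm]

omit [Fintype V] [DecidableEq V] [DecidableRel G.Adj] in
theorem compatCoef_eq (d : G.Dart) (j : ℕ) (y : X) :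
    M.compatCoef μ φ d j y =
      (∫ x, M.updateKernel d x y * φ j x ∂μ) / ∫ x, M.updateKernel d x y ∂μ := by
  rw [compatCoef, basisCoef, ← beta_eq_integral, ← integral_div]
  refine integral_congr_ae (ae_of_all _ fun x => ?_)
  simp only [compat, updateKernel]
  ring

theorem bpUpdate_eq (m : G.Dart → X → ℝ) (d : G.Dart) (x : X) :
    M.bpUpdate μ m d x = (∫ y, M.updateKernel d x y * ∏ f ∈ incoming G d, m f y ∂μ) /
      ∫ x', ∫ y, M.updateKernel d x' y * ∏ f ∈ incoming G d, m f y ∂μ ∂μ :=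
  rfl

variable {M μ φ} [IsFiniteMeasure μ]

omit [Fintype V] [DecidableEq V] [DecidableRel G.Adj] in
theorem measurable_compatCoef (hK : M.HasBoundedKernels) (hφ : IsOrthonormalBasisL2 μ φ)
    (d : G.Dart) (j : ℕ) : Measurable (M.compatCoef μ φ d j) := by
  obtain ⟨c₁, c₂, h⟩ := hK d
  have e : M.compatCoef μ φ d j = fun y =>
      (∫ x, M.updateKernel d x y * φ j x ∂μ) / ∫ x, M.updateKernel d x y ∂μ :=
    funext fun y => M.compatCoef_eq μ φ d j y
  rw [e]
  exact (h.measurable_integral_mul (hφ.1 j)).div h.measurable_integral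

omit [DecidableEq V] in
theorem abs_compatCoef_le_bound (hK : M.HasBoundedKernels) (hφ : IsOrthonormalBasisL2 μ φ)
    (d : G.Dart) (j : ℕ) (y : X) : |M.compatCoef μ φ d j y| ≤ M.bound μ φ j := by
  -- A real supremum takes the value 0 on unbounded families, so boundedness must be known before
  -- `bound` dominates anything.
  have hbdd : BddAbove (Set.range fun y => |M.compatCoef μ φ d j y|) := by
    obtain ⟨c₁, c₂, h⟩ := hK d
    refine ⟨(c₂ * ∫ x, |φ j x| ∂μ) / (c₁ * μ.real Set.univ), ?_⟩
    rintro _ ⟨y, rfl⟩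
    simp only [compatCoef_eq]
    exact h.abs_integral_mul_div_le hφ.measure_ne_zero ((hφ.memLp j).integrable one_le_two) y
  exact (le_ciSup hbdd y).trans
    (le_ciSup (f := fun d => ⨆ y, |M.compatCoef μ φ d j y|) (Set.finite_range _).bddAbove d)

omit [Fintype V] [DecidableEq V] [DecidableRel G.Adj] [IsFiniteMeasure μ] in
theorem bound_nonneg (j : ℕ) : 0 ≤ M.bound μ φ j :=
  Real.iSup_nonneg fun _ => Real.iSup_nonneg fun _ => abs_nonneg _

section FixedPoint

variable {mstar : G.Dart → X → ℝ}

omit [IsFiniteMeasure μ] in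
theorem IsBPFixedPoint.eq_update (hfix : M.IsBPFixedPoint μ mstar) (d : G.Dart) (x : X) :
    mstar d x = (∫ y, M.updateKernel d x y * ∏ f ∈ incoming G d, mstar f y ∂μ) /
      ∫ x', ∫ y, M.updateKernel d x' y * ∏ f ∈ incoming G d, mstar f y ∂μ ∂μ := by
  rw [← bpUpdate_eq, hfix.2]

omit [IsFiniteMeasure μ] in
theorem IsBPFixedPoint.prod_nonneg (hfix : M.IsBPFixedPoint μ mstar) (d : G.Dart) (y : X) :
    0 ≤ ∏ f ∈ incoming G d, mstar f y :=
  Finset.prod_nonneg fun f _ => (hfix.1 f).1 y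

omit [IsFiniteMeasure μ] in
theorem IsBPFixedPoint.aestronglyMeasurable_prod (hfix : M.IsBPFixedPoint μ mstar) (d : G.Dart) :
    AEStronglyMeasurable (fun y => ∏ f ∈ incoming G d, mstar f y) μ :=
  Finset.aestronglyMeasurable_fun_prod _ fun f _ => (hfix.1 f).2.1.aestronglyMeasurable

theorem IsBPFixedPoint.exists_le (hfix : M.IsBPFixedPoint μ mstar) (hK : M.HasBoundedKernels)
    (hμ : μ ≠ 0) : ∃ C, ∀ d x, mstar d x ≤ C := by
  choose c₁ c₂ h using hK
  obtain ⟨C, hC⟩ := (Set.finite_range fun d => c₂ d / (c₁ d * μ.real Set.univ)).bddAbove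
  exact ⟨C, fun d x => ((h d).update_le hμ (hfix.prod_nonneg d)
    (hfix.aestronglyMeasurable_prod d) (hfix.eq_update d) (hfix.1 d).2.2 x).trans (hC ⟨d, rfl⟩)⟩

theorem IsBPFixedPoint.memLp (hfix : M.IsBPFixedPoint μ mstar) (hK : M.HasBoundedKernels)
    (hμ : μ ≠ 0) (d : G.Dart) : MemLp (mstar d) 2 μ := by
  obtain ⟨C, hC⟩ := hfix.exists_le hK hμ
  refine MemLp.of_bound (hfix.1 d).2.1.aestronglyMeasurable C (ae_of_all _ fun x => ?_)
  rw [Real.norm_of_nonneg ((hfix.1 d).1 x)]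
  exact hC d x

omit [Fintype V] [DecidableEq V] [DecidableRel G.Adj] in
theorem integrable_beta_mul (hK : M.HasBoundedKernels) (hμ : μ ≠ 0) (d : G.Dart) {w : X → ℝ}
    (hw : Integrable w μ) : Integrable (fun y => M.beta μ d y * w y) μ := by
  obtain ⟨c₁, c₂, h⟩ := hK d
  simp_rw [beta_eq_integral]
  refine hw.bdd_mul (c := c₂ * μ.real Set.univ) h.measurable_integral.aestronglyMeasurable
    (ae_of_all _ fun y => ?_)
  rw [Real.norm_of_nonneg (h.integral_pos hμ y).le]
  exact h.integral_le y

omit [Fintype V] [DecidableEq V] [DecidableRel G.Adj] in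
theorem beta_pos (hK : M.HasBoundedKernels) (hμ : μ ≠ 0) (d : G.Dart) (y : X) :
    0 < M.beta μ d y := by
  obtain ⟨c₁, c₂, h⟩ := hK d
  rw [beta_eq_integral]
  exact h.integral_pos hμ y

omit [Fintype V] [DecidableEq V] [DecidableRel G.Adj] in
theorem measurable_beta (hK : M.HasBoundedKernels) (d : G.Dart) : Measurable (M.beta μ d) := by
  obtain ⟨c₁, c₂, h⟩ := hK d
  rw [funext (M.beta_eq_integral μ d)]
  exact h.measurable_integral

theorem IsBPFixedPoint.integrable_weight (hfix : M.IsBPFixedPoint μ mstar)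
    (hK : M.HasBoundedKernels) (hμ : μ ≠ 0) (d : G.Dart) :
    Integrable (fun y => M.beta μ d y * ∏ f ∈ incoming G d, mstar f y) μ := by
  obtain ⟨c₁, c₂, h⟩ := id hK d
  exact integrable_beta_mul hK hμ d (h.integrable_of_update (hfix.prod_nonneg d)
    (hfix.aestronglyMeasurable_prod d) (hfix.eq_update d) (hfix.1 d).2.2)

theorem IsBPFixedPoint.integral_weight_pos (hfix : M.IsBPFixedPoint μ mstar)
    (hK : M.HasBoundedKernels) (hμ : μ ≠ 0) (d : G.Dart) :
    0 < ∫ y, M.beta μ d y * ∏ f ∈ incoming G d, mstar f y ∂μ := by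
  obtain ⟨c₁, c₂, h⟩ := id hK d
  have hp := h.integral_pos_of_update (hfix.prod_nonneg d)
    (hfix.aestronglyMeasurable_prod d) (hfix.eq_update d) (hfix.1 d).2.2
  have hwi := h.integrable_of_update (hfix.prod_nonneg d)
    (hfix.aestronglyMeasurable_prod d) (hfix.eq_update d) (hfix.1 d).2.2
  refine (mul_pos (mul_pos h.pos (measureReal_univ_pos_of_ne_zero hμ)) hp).trans_le ?_
  rw [← integral_const_mul]
  refine integral_mono (hwi.const_mul _) (hfix.integrable_weight hK hμ d) fun y => ?_
  simp only [beta_eq_integral]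
  exact mul_le_mul_of_nonneg_right (h.le_integral y) (hfix.prod_nonneg d y)

/-- The coefficients of the fixed point are averages of the coefficients of `Γ`. -/
theorem IsBPFixedPoint.basisCoef_eq (hfix : M.IsBPFixedPoint μ mstar) (hK : M.HasBoundedKernels)
    (hφ : IsOrthonormalBasisL2 μ φ) (d : G.Dart) (j : ℕ) :
    basisCoef μ φ (mstar d) j =
      (∫ y, (M.beta μ d y * ∏ f ∈ incoming G d, mstar f y) * M.compatCoef μ φ d j y ∂μ) /
        ∫ y, M.beta μ d y * ∏ f ∈ incoming G d, mstar f y ∂μ := by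
  obtain ⟨c₁, c₂, h⟩ := hK d
  simp_rw [compatCoef_eq, beta_eq_integral]
  exact h.integral_update_mul hφ.measure_ne_zero (hfix.prod_nonneg d)
    (hfix.aestronglyMeasurable_prod d) (hfix.eq_update d) (hfix.1 d).2.2
    ((hφ.memLp j).integrable one_le_two)

theorem IsBPFixedPoint.abs_basisCoef_le (hfix : M.IsBPFixedPoint μ mstar)
    (hK : M.HasBoundedKernels) (hφ : IsOrthonormalBasisL2 μ φ) (d : G.Dart) (j : ℕ) :
    |basisCoef μ φ (mstar d) j| ≤ M.bound μ φ j := by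
  have hμ := hφ.measure_ne_zero
  rw [hfix.basisCoef_eq hK hφ]
  exact abs_weighted_average_le
    (fun y => mul_nonneg (beta_pos hK hμ d y).le (hfix.prod_nonneg d y))
    (hfix.integrable_weight hK hμ d) (hfix.integral_weight_pos hK hμ d)
    (abs_compatCoef_le_bound hK hφ d j)

end FixedPoint

end PairwiseMRF
end

/-! ### The bias of one update and deterministic bounds on the iterates. -/

noncomputable section

namespace PairwiseMRF

variable {V : Type*} [Fintype V] [DecidableEq V] {G : SimpleGraph V} [DecidableRel G.Adj]
  {X : Type*} [MeasurableSpace X] {M : PairwiseMRF G X} {μ : Measure X} {φ : ℕ → X → ℝ}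
  {r : ℕ} {mstar : G.Dart → X → ℝ}

section Bias

omit [Fintype V] [DecidableEq V] [DecidableRel G.Adj] in
-- Boundedness of the first r basis functions gives a sup bound common to all admissible messages,
-- which is why κ below is the same for every run.
theorem exists_abs_expansion_le (hφ_bdd : ∀ j < r, ∃ C : ℝ, ∀ x, |φ j x| ≤ C) :
    ∃ C, ∀ a : Fin r → ℝ, (∀ j : Fin r, |a j| ≤ M.bound μ φ j) →
      ∀ x, |expansion φ a x| ≤ C := by
  choose! C hC using hφ_bdd
  refine ⟨∑ j : Fin r, M.bound μ φ j * C j, fun a ha x => ?_⟩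
  refine (Finset.abs_sum_le_sum_abs _ _).trans (Finset.sum_le_sum fun j _ => ?_)
  rw [abs_mul]
  exact mul_le_mul (ha j) (hC j j.2 x) (abs_nonneg _) (bound_nonneg _)

theorem measurable_expansion (hφ : IsOrthonormalBasisL2 μ φ) (a : Fin r → ℝ) :
    Measurable (expansion φ a) :=
  Finset.measurable_fun_sum _ fun j _ => (hφ.1 j).const_mul (a j)

variable [IsFiniteMeasure μ]

/-- For admissible positive current messages the sampling law is a probability measure, and the
bias of the coefficients computed from a sample is controlled by the `L²` distance of the incoming
messages to the fixed point. -/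
theorem exists_bias_le (hK : M.HasBoundedKernels) (hφ : IsOrthonormalBasisL2 μ φ)
    (hφ_bdd : ∀ j < r, ∃ C : ℝ, ∀ x, |φ j x| ≤ C) (hfix : M.IsBPFixedPoint μ mstar)
    (d : G.Dart) :
    ∃ κ : ℝ, 0 ≤ κ ∧ ∀ a : G.Dart → Fin r → ℝ, (∀ f (j : Fin r), |a f j| ≤ M.bound μ φ j) →
      (∀ f x, 0 < expansion φ (a f) x) →
      IsProbabilityMeasure (M.sampleLaw μ φ a d) ∧
      ∀ j : ℕ, (∫ y, M.compatCoef μ φ d j y ∂(M.sampleLaw μ φ a d) -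
          basisCoef μ φ (mstar d) j) ^ 2 ≤
        M.bound μ φ j ^ 2 * (κ * ∑ f ∈ incoming G d,
          (normSqL2 μ (fun x => expansion φ (a f) x - projBasis μ φ r (mstar f) x) +
            approxErrVec μ φ r mstar f)) := by
  have hμ := hφ.measure_ne_zero
  obtain ⟨C₁, hC₁⟩ := hfix.exists_le hK hμ
  obtain ⟨C₂, hC₂⟩ := exists_abs_expansion_le (M := M) (μ := μ) hφ_bdd
  set C := max 1 (max C₁ C₂) with hC
  have hC1 : 1 ≤ C := le_max_left _ _
  have hC1C : C₁ ≤ C := (le_max_left _ _).trans (le_max_right _ _)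
  have hC2C : C₂ ≤ C := (le_max_right _ _).trans (le_max_right _ _)
  obtain ⟨c₁, c₂, hk⟩ := id hK d
  set b := c₂ * μ.real Set.univ with hb
  have hβ0 : ∀ y, 0 < M.beta μ d y := beta_pos hK hμ d
  have hβb : ∀ y, M.beta μ d y ≤ b := fun y => by
    rw [beta_eq_integral]
    exact hk.integral_le y
  set n := (incoming G d).card with hn
  set Z := ∫ y, M.beta μ d y * ∏ f ∈ incoming G d, mstar f y ∂μ with hZdef
  have hZ : 0 < Z := hfix.integral_weight_pos hK hμ d
  -- The square is the Lipschitz constant without its factor B_j, where Z is the mass of the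
  -- fixed-point weight and bCⁿ compares products in L¹. The factors n and μ(X) come from
  -- Cauchy–Schwarz over the incoming edges and over the space.
  refine ⟨(2 * (b * C ^ n) / Z) ^ 2 * (n * μ.real Set.univ), by positivity, ?_⟩
  intro a ha hpos
  set w : X → ℝ := fun y => M.beta μ d y * ∏ f ∈ incoming G d, max 0 (expansion φ (a f) y) with hw
  have haC : ∀ f x, |expansion φ (a f) x| ≤ C := fun f x => (hC₂ _ (ha f) x).trans hC2C
  have hmax0 : ∀ f x, 0 ≤ max 0 (expansion φ (a f) x) := fun f x => le_max_left _ _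
  have hmaxC : ∀ f x, max 0 (expansion φ (a f) x) ≤ C := fun f x =>
    max_le (by linarith) ((le_abs_self _).trans (haC f x))
  have hw0 : ∀ y, 0 < w y := fun y =>
    mul_pos (hβ0 y) (Finset.prod_pos fun f _ => lt_max_of_lt_right (hpos f y))
  have hprodm : Measurable fun y => ∏ f ∈ incoming G d, max 0 (expansion φ (a f) y) :=
    Finset.measurable_fun_prod _ fun f _ => measurable_const.max (measurable_expansion hφ (a f))
  have hwm : Measurable w := (measurable_beta hK d).mul hprodm
  have hprodi : Integrable (fun y => ∏ f ∈ incoming G d, max 0 (expansion φ (a f) y)) μ := by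
    refine Integrable.of_bound hprodm.aestronglyMeasurable (C ^ n) (ae_of_all _ fun y => ?_)
    rw [Real.norm_of_nonneg (Finset.prod_nonneg fun f _ => hmax0 f y), hn, ← Finset.prod_const]
    exact Finset.prod_le_prod (fun f _ => hmax0 f y) fun f _ => hmaxC f y
  have hwi : Integrable w μ := integrable_beta_mul hK hμ d hprodi
  have hwZ : 0 < ∫ y, w y ∂μ := by
    rw [integral_pos_iff_support_of_nonneg (fun y => (hw0 y).le) hwi]
    have : Function.support w = Set.univ := Set.eq_univ_of_forall fun y => (hw0 y).ne'
    rw [this]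
    exact Measure.measure_univ_pos.mpr hμ
  refine ⟨isProbabilityMeasure_normalizedMeasure (fun y => (hw0 y).le) hwi hwZ, fun j => ?_⟩
  rw [sampleLaw, integral_normalizedMeasure (fun y => (hw0 y).le) hwm hwi,
    hfix.basisCoef_eq hK hφ]
  have hlip := abs_weighted_average_sub_le (g := M.compatCoef μ φ d j) (fun y => (hw0 y).le) hwi
    (hfix.integrable_weight hK hμ d) hwZ hZ (measurable_compatCoef hK hφ d j).aestronglyMeasurable
    (bound_nonneg j) (abs_compatCoef_le_bound hK hφ d j)
  rw [← hZdef] at hlip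
  have hL2 : ∀ f, MemLp (fun y => expansion φ (a f) y - mstar f y) 2 μ := fun f =>
    (hφ.memLp_expansion (a f)).sub (hfix.memLp hK hμ f)
  have hL1 : ∀ f, Integrable (fun y => |expansion φ (a f) y - mstar f y|) μ := fun f =>
    ((hL2 f).integrable one_le_two).abs
  have hD : ∫ y, |w y - M.beta μ d y * ∏ f ∈ incoming G d, mstar f y| ∂μ ≤
      b * C ^ n * ∑ f ∈ incoming G d, ∫ y, |expansion φ (a f) y - mstar f y| ∂μ := by
    rw [← integral_finsetSum _ fun f _ => hL1 f, ← integral_const_mul]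
    refine integral_mono (hwi.sub (hfix.integrable_weight hK hμ d)).abs
      ((integrable_finsetSum _ fun f _ => hL1 f).const_mul _) fun y => ?_
    simp only [hw, ← mul_sub, abs_mul, abs_of_pos (hβ0 y), mul_assoc]
    refine mul_le_mul (hβb y) ?_ (abs_nonneg _) ((hβ0 y).le.trans (hβb y))
    refine (abs_prod_sub_prod_le _ hC1 (fun f => hmax0 f y) (fun f => (hfix.1 f).1 y)
      (fun f => hmaxC f y) fun f => (hC₁ f y).trans hC1C).trans ?_
    refine mul_le_mul_of_nonneg_left (Finset.sum_le_sum fun f _ => ?_) (by positivity)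
    calc |max 0 (expansion φ (a f) y) - mstar f y|
        = |max (expansion φ (a f) y) 0 - max (mstar f y) 0| := by
          rw [max_comm, max_eq_left ((hfix.1 f).1 y)]
      _ ≤ _ := abs_max_sub_max_le_abs _ _ _
  have hb0 : 0 ≤ b := (hβ0 (Classical.choice (by
    by_contra hcon
    rw [not_nonempty_iff] at hcon
    exact hμ (Measure.eq_zero_of_isEmpty μ)))).le.trans (hβb _)
  have hsq : (∑ f ∈ incoming G d, ∫ y, |expansion φ (a f) y - mstar f y| ∂μ) ^ 2 ≤
      n * μ.real Set.univ * ∑ f ∈ incoming G d,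
        (normSqL2 μ (fun x => expansion φ (a f) x - projBasis μ φ r (mstar f) x) +
          approxErrVec μ φ r mstar f) := by
    refine (sq_sum_le_card_mul_sum_sq (α := ℝ)).trans ?_
    rw [mul_assoc, ← hn, Finset.mul_sum _ _ (μ.real Set.univ)]
    refine mul_le_mul_of_nonneg_left (Finset.sum_le_sum fun f _ => ?_) (Nat.cast_nonneg _)
    have := hφ.normSqL2_expansion_sub (hfix.memLp hK hμ f) (a f)
    rw [approxErrVec]
    unfold approxErr
    rw [← this, normSqL2]
    exact sq_integral_abs_le (hL2 f)
  have hmul : |(∫ y, w y * M.compatCoef μ φ d j y ∂μ) / (∫ y, w y ∂μ) -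
      (∫ y, (M.beta μ d y * ∏ f ∈ incoming G d, mstar f y) * M.compatCoef μ φ d j y ∂μ) / Z| ≤
      M.bound μ φ j * (2 * (b * C ^ n) / Z) *
        ∑ f ∈ incoming G d, ∫ y, |expansion φ (a f) y - mstar f y| ∂μ := by
    refine hlip.trans ?_
    rw [div_le_iff₀ hZ]
    calc _ ≤ 2 * M.bound μ φ j * (b * C ^ n *
          ∑ f ∈ incoming G d, ∫ y, |expansion φ (a f) y - mstar f y| ∂μ) :=
          mul_le_mul_of_nonneg_left hD (mul_nonneg zero_le_two (bound_nonneg j))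
      _ = _ := by
          field_simp
  calc _ ≤ (M.bound μ φ j * (2 * (b * C ^ n) / Z) *
        ∑ f ∈ incoming G d, ∫ y, |expansion φ (a f) y - mstar f y| ∂μ) ^ 2 :=
        sq_le_sq' (abs_le.mp hmul).1 (abs_le.mp hmul).2
    _ = M.bound μ φ j ^ 2 * ((2 * (b * C ^ n) / Z) ^ 2 *
        (∑ f ∈ incoming G d, ∫ y, |expansion φ (a f) y - mstar f y| ∂μ) ^ 2) := by ring
    _ ≤ M.bound μ φ j ^ 2 * ((2 * (b * C ^ n) / Z) ^ 2 * (n * μ.real Set.univ *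
        ∑ f ∈ incoming G d,
        (normSqL2 μ (fun x => expansion φ (a f) x - projBasis μ φ r (mstar f) x) +
          approxErrVec μ φ r mstar f))) := by gcongr
    _ = _ := by ring

end Bias

section Algorithm

variable (M μ φ) in
/-- The average over the `k` samples of iteration `s` of the coefficients of `Γ`. -/
def sampleMean {k : ℕ} (y : ℕ → G.Dart → Fin k → X) (s : ℕ) (d : G.Dart) (j : ℕ) : ℝ :=
  1 / (k : ℝ) * ∑ i, M.compatCoef μ φ d j (y s d i)

variable {k : ℕ}

omit [Fintype V] [DecidableEq V] [DecidableRel G.Adj] in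
-- Steps 1/(t+1) produce a running mean, and at t = 0 the factor 1 - 1/(0+1) vanishes, which
-- discards a^0.
theorem sosmpCoef_eq_average (y : ℕ → G.Dart → Fin k → X) {t : ℕ} (ht : 1 ≤ t) (d : G.Dart)
    (j : Fin r) :
    M.sosmpCoef μ φ r y t d j =
      1 / (t : ℝ) * ∑ s ∈ Finset.range t, M.sampleMean μ φ y s d j := by
  induction t, ht using Nat.le_induction with
  | base => simp [sosmpCoef, sampleMean]
  | succ t ht ih =>
    have ht' : (0 : ℝ) < t := by exact_mod_cast ht
    simp only [sosmpCoef]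
    rw [ih, Finset.sum_range_succ, ← sampleMean]
    push_cast
    field_simp
    ring

omit [Fintype V] [DecidableEq V] [DecidableRel G.Adj] in
-- For t ≥ 1 the message is an average of functions Π^r Γ(·, y), each positive.
theorem expansion_sosmpCoef_pos (hcond : M.ApproxCondition μ φ r mstar) (hk : 0 < k)
    (y : ℕ → G.Dart → Fin k → X) {t : ℕ} (ht : 1 ≤ t) (d : G.Dart) (x : X) :
    0 < expansion φ (M.sosmpCoef μ φ r y t d) x := by
  have hpos : ∀ z, 0 < expansion φ (fun j : Fin r => M.compatCoef μ φ d j z) x := by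
    intro z
    have h := (hcond d x).1
    -- A real infimum over a set unbounded below is 0, so its positivity already implies boundedness
    -- below.
    have hbdd : BddBelow (Set.range fun z => projBasis μ φ r (fun x' => M.compat μ d x' z) x) := by
      by_contra hcon
      rw [Real.iInf_of_not_bddBelow hcon] at h
      exact h.false
    exact h.trans_le (ciInf_le hbdd z)
  have e : expansion φ (M.sosmpCoef μ φ r y t d) x = 1 / (t : ℝ) * ∑ s ∈ Finset.range t,
      1 / (k : ℝ) * ∑ i, expansion φ (fun j : Fin r => M.compatCoef μ φ d j (y s d i)) x := by
    simp only [expansion, sosmpCoef_eq_average y ht, sampleMean, Finset.mul_sum, Finset.sum_mul]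
    rw [Finset.sum_comm]
    refine Finset.sum_congr rfl fun s _ => ?_
    rw [Finset.sum_comm]
    refine Finset.sum_congr rfl fun i _ => Finset.sum_congr rfl fun j _ => by ring
  rw [e]
  have ht' : (0 : ℝ) < t := by exact_mod_cast ht
  have hk' : (0 : ℝ) < k := by exact_mod_cast hk
  have : Nonempty (Fin k) := ⟨⟨0, hk⟩⟩
  refine mul_pos (by positivity) (Finset.sum_pos (fun s _ => mul_pos (by positivity)
    (Finset.sum_pos (fun i _ => hpos _) Finset.univ_nonempty)) ?_)
  simpa using (by omega : t ≠ 0)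

theorem abs_average_le {n : ℕ} {u : Fin n → ℝ} {B : ℝ} (hB : 0 ≤ B) (hu : ∀ i, |u i| ≤ B) :
    |1 / (n : ℝ) * ∑ i, u i| ≤ B := by
  rw [abs_mul, abs_of_nonneg (by positivity), one_div, inv_mul_eq_div]
  refine div_le_of_le_mul₀ (Nat.cast_nonneg n) hB ?_
  refine (Finset.abs_sum_le_sum_abs _ _).trans ((Finset.sum_le_sum fun i _ => hu i).trans ?_)
  simp [mul_comm]

variable [IsFiniteMeasure μ]

omit [DecidableEq V] in
theorem abs_sampleMean_le (hK : M.HasBoundedKernels) (hφ : IsOrthonormalBasisL2 μ φ)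
    (y : ℕ → G.Dart → Fin k → X) (s : ℕ) (d : G.Dart) (j : ℕ) :
    |M.sampleMean μ φ y s d j| ≤ M.bound μ φ j :=
  abs_average_le (bound_nonneg j) fun i => abs_compatCoef_le_bound hK hφ d j (y s d i)

omit [DecidableEq V] in
theorem abs_sosmpCoef_le (hK : M.HasBoundedKernels) (hφ : IsOrthonormalBasisL2 μ φ)
    (y : ℕ → G.Dart → Fin k → X) {t : ℕ} (ht : 1 ≤ t) (d : G.Dart) (j : Fin r) :
    |M.sosmpCoef μ φ r y t d j| ≤ M.bound μ φ j := by
  rw [sosmpCoef_eq_average y ht, ← Fin.sum_univ_eq_sum_range fun s => M.sampleMean μ φ y s d j]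
  exact abs_average_le (bound_nonneg j) fun s => abs_sampleMean_le hK hφ y s d j

omit [Fintype V] [DecidableEq V] [DecidableRel G.Adj] [IsFiniteMeasure μ] in
theorem estErrVec_eq_sum (hφ : IsOrthonormalBasisL2 μ φ) (y : ℕ → G.Dart → Fin k → X) (t : ℕ)
    (d : G.Dart) :
    M.estErrVec μ φ r mstar y t d =
      ∑ j : Fin r, (M.sosmpCoef μ φ r y t d j - basisCoef μ φ (mstar d) j) ^ 2 :=
  hφ.normSqL2_expansion_sub_projBasis _ _

omit [Fintype V] [DecidableEq V] [DecidableRel G.Adj] [IsFiniteMeasure μ] in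
theorem estErrVec_nonneg (y : ℕ → G.Dart → Fin k → X) (t : ℕ) (d : G.Dart) :
    0 ≤ M.estErrVec μ φ r mstar y t d :=
  integral_nonneg fun _ => sq_nonneg _

omit [Fintype V] [DecidableEq V] [DecidableRel G.Adj] [IsFiniteMeasure μ] in
theorem approxErrVec_nonneg (d : G.Dart) : 0 ≤ approxErrVec μ φ r mstar d :=
  integral_nonneg fun _ => sq_nonneg _

end Algorithm

end PairwiseMRF
end

/-! ### Martingale noise and the random recursion for the squared errors. -/

noncomputable section

section Past

variable {Ω Z : Type*} [mΩ : MeasurableSpace Ω] [MeasurableSpace Z]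

/-- The σ-algebra generated by the first `t` terms of a process. -/
@[reducible]
def past (Y : ℕ → Ω → Z) (t : ℕ) : MeasurableSpace Ω :=
  MeasurableSpace.comap (fun ω (s : Fin t) => Y s ω) inferInstance

variable {Y : ℕ → Ω → Z}

theorem past_le (hY : ∀ t, Measurable (Y t)) (t : ℕ) : past Y t ≤ mΩ :=
  Measurable.comap_le (measurable_pi_lambda (fun ω (s : Fin t) => Y s ω) fun s => hY s)

omit mΩ in
theorem measurable_past {s t : ℕ} (h : s < t) : Measurable[past Y t] (Y s) :=
  (measurable_pi_apply (⟨s, h⟩ : Fin t)).comp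
    (comap_measurable fun ω (s : Fin t) => Y s ω)

omit mΩ in
theorem past_mono {s t : ℕ} (h : s ≤ t) : past Y s ≤ past Y t :=
  Measurable.comap_le (@measurable_pi_lambda _ _ _ (past Y t) _ _ fun i : Fin s =>
    measurable_past (i.2.trans_le h))

end Past

/-- Jensen is applied to the bias b only. The noise ξ is squared after averaging, since its decay
comes from cancellation. -/
theorem sq_average_add_le {t : ℕ} (b ξ : ℕ → ℝ) :
    (1 / (t : ℝ) * ∑ s ∈ Finset.range t, (b s + ξ s)) ^ 2 ≤
      1 / (t : ℝ) * ∑ s ∈ Finset.range t, 2 * b s ^ 2 +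
        2 * (1 / (t : ℝ) * ∑ s ∈ Finset.range t, ξ s) ^ 2 := by
  have h1 : (1 / (t : ℝ) * ∑ s ∈ Finset.range t, b s) ^ 2 ≤
      1 / (t : ℝ) * ∑ s ∈ Finset.range t, b s ^ 2 := by
    rcases Nat.eq_zero_or_pos t with rfl | ht
    · simp
    · have ht' : (0 : ℝ) < t := by exact_mod_cast ht
      have h := sq_sum_le_card_mul_sum_sq (α := ℝ) (s := Finset.range t) (f := b)
      rw [Finset.card_range] at h
      rw [mul_pow, div_pow, one_pow, one_div_mul_eq_div, one_div_mul_eq_div,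
        div_le_div_iff₀ (by positivity) ht']
      nlinarith
  rw [Finset.sum_add_distrib, mul_add, ← Finset.mul_sum]
  nlinarith [sq_nonneg ((1 / (t : ℝ) * ∑ s ∈ Finset.range t, b s) -
    (1 / (t : ℝ) * ∑ s ∈ Finset.range t, ξ s))]

namespace PairwiseMRF

variable {V : Type*} [Fintype V] [DecidableEq V] {G : SimpleGraph V} [DecidableRel G.Adj]
  {X : Type*} [MeasurableSpace X] {M : PairwiseMRF G X} {μ : Measure X} {φ : ℕ → X → ℝ}
  {r : ℕ} {mstar : G.Dart → X → ℝ} {k : ℕ} [IsFiniteMeasure μ]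
  {Ω : Type*} [mΩ : MeasurableSpace Ω] {P : Measure Ω} [IsProbabilityMeasure P]
  {Y : ℕ → Ω → G.Dart → Fin k → X}

omit [Fintype V] [DecidableEq V] [DecidableRel G.Adj] in
theorem measurable_sampleMean (hK : M.HasBoundedKernels) (hφ : IsOrthonormalBasisL2 μ φ)
    {Ω : Type*} {m : MeasurableSpace Ω} {Y : ℕ → Ω → G.Dart → Fin k → X} {s : ℕ}
    (hY : Measurable (Y s)) (d : G.Dart) (j : ℕ) :
    Measurable fun ω => M.sampleMean μ φ (fun s => Y s ω) s d j := by
  refine (Finset.measurable_fun_sum _ fun i _ => ?_).const_mul _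
  exact (measurable_compatCoef hK hφ d j).comp
    ((measurable_pi_apply i).comp ((measurable_pi_apply d).comp hY))

variable (M μ φ P Y) in
/-- The conditional expectation of the sampled coefficients given the past. -/
def condMean (d : G.Dart) (j s : ℕ) : Ω → ℝ :=
  P[fun ω => M.sampleMean μ φ (fun s => Y s ω) s d j | past Y s]

variable (M μ φ P Y) in
/-- The fluctuation of the sampled coefficients around their conditional expectation. -/
def noise (d : G.Dart) (j s : ℕ) (ω : Ω) : ℝ :=
  M.sampleMean μ φ (fun s => Y s ω) s d j - M.condMean μ φ P Y d j s ω

omit [DecidableEq V] in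
theorem integrable_sampleMean (hK : M.HasBoundedKernels) (hφ : IsOrthonormalBasisL2 μ φ)
    (hY : ∀ t, Measurable (Y t)) (d : G.Dart) (j s : ℕ) :
    Integrable (fun ω => M.sampleMean μ φ (fun s => Y s ω) s d j) P :=
  Integrable.of_bound (measurable_sampleMean hK hφ (hY s) d j).aestronglyMeasurable
    (M.bound μ φ j) (ae_of_all _ fun _ => abs_sampleMean_le hK hφ _ s d j)

omit [DecidableEq V] [IsProbabilityMeasure P] in
theorem abs_condMean_le (hK : M.HasBoundedKernels) (hφ : IsOrthonormalBasisL2 μ φ)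
    (d : G.Dart) (j s : ℕ) : ∀ᵐ ω ∂P, |M.condMean μ φ P Y d j s ω| ≤ M.bound μ φ j :=
  ae_bdd_abs_condExp_of_ae_bdd_abs
    (ae_of_all _ fun _ => abs_sampleMean_le hK hφ _ s d j)

omit [DecidableEq V] [IsProbabilityMeasure P] in
theorem abs_noise_le (hK : M.HasBoundedKernels) (hφ : IsOrthonormalBasisL2 μ φ)
    (d : G.Dart) (j s : ℕ) : ∀ᵐ ω ∂P, |M.noise μ φ P Y d j s ω| ≤ 2 * M.bound μ φ j := by
  filter_upwards [abs_condMean_le (P := P) (Y := Y) hK hφ d j s] with ω hω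
  have h := abs_sampleMean_le hK hφ (fun s => Y s ω) s d j
  refine (abs_sub _ _).trans ?_
  linarith

omit [Fintype V] [DecidableEq V] [DecidableRel G.Adj] [IsProbabilityMeasure P] in
theorem stronglyMeasurable_noise (hK : M.HasBoundedKernels) (hφ : IsOrthonormalBasisL2 μ φ)
    (d : G.Dart) (j : ℕ) {s t : ℕ} (h : s < t) :
    StronglyMeasurable[past Y t] (M.noise μ φ P Y d j s) :=
  StronglyMeasurable.sub (measurable_sampleMean hK hφ (measurable_past h) d j).stronglyMeasurable
    (stronglyMeasurable_condExp.mono (past_mono h.le))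

omit [DecidableEq V] in
-- The noise of iteration s is known to the past of any later t, and the noise of t is centred given
-- that past.
theorem integral_noise_mul_noise (hK : M.HasBoundedKernels) (hφ : IsOrthonormalBasisL2 μ φ)
    (hY : ∀ t, Measurable (Y t)) (d : G.Dart) (j : ℕ) {s t : ℕ} (h : s < t) :
    ∫ ω, M.noise μ φ P Y d j s ω * M.noise μ φ P Y d j t ω ∂P = 0 :=
  integral_mul_sub_condExp_eq_zero (past_le hY t) (stronglyMeasurable_noise hK hφ d j h)
    (abs_noise_le hK hφ d j s) (integrable_sampleMean hK hφ hY d j t)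

omit [Fintype V] [DecidableEq V] [DecidableRel G.Adj] [IsProbabilityMeasure P] in
theorem aestronglyMeasurable_noise (hK : M.HasBoundedKernels) (hφ : IsOrthonormalBasisL2 μ φ)
    (hY : ∀ t, Measurable (Y t)) (d : G.Dart) (j s : ℕ) :
    AEStronglyMeasurable (M.noise μ φ P Y d j s) P :=
  ((stronglyMeasurable_noise hK hφ d j s.lt_succ_self).mono (past_le hY _)).aestronglyMeasurable

/-- The conditional expectation of the sampled coefficients is the expectation under the sampling
law. -/
theorem condMean_ae_eq (hK : M.HasBoundedKernels) (hφ : IsOrthonormalBasisL2 μ φ) (hk : 0 < k)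
    (hrun : M.IsSOSMPRun μ φ r k P Y) {t : ℕ} {d : G.Dart}
    (hprob : ∀ ω, IsProbabilityMeasure
      (M.sampleLaw μ φ (M.sosmpCoef μ φ r (fun s => Y s ω) t) d)) (j : ℕ) :
    M.condMean μ φ P Y d j t =ᵐ[P] fun ω =>
      ∫ y, M.compatCoef μ φ d j y ∂(M.sampleLaw μ φ (M.sosmpCoef μ φ r (fun s => Y s ω) t) d) := by
  set κ : Ω → Measure X := fun ω =>
    M.sampleLaw μ φ (M.sosmpCoef μ φ r (fun s => Y s ω) t) d with hκ
  have hκp : ∀ ω, IsProbabilityMeasure (κ ω) := hprob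
  have hpast := past_le hrun.1 t
  have hmeas : ∀ i, Measurable fun ω => Y t ω d i := fun i =>
    (measurable_pi_apply i).comp ((measurable_pi_apply d).comp (hrun.1 t))
  have hone : ∀ i, P[fun ω => M.compatCoef μ φ d j (Y t ω d i) | past Y t] =ᵐ[P] fun ω =>
      ∫ y, M.compatCoef μ φ d j y ∂(κ ω) := by
    intro i
    refine condExp_comp_ae_eq_integral hpast (hmeas i) (fun B hB => ?_)
      (measurable_compatCoef hK hφ d j) (bound_nonneg j) (abs_compatCoef_le_bound hK hφ d j)
    -- The i-th marginal of the product law is the sampling law; this uses that the latter has total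
    -- mass 1.
    refine (hrun.2 t d (Function.eval i ⁻¹' B) (measurable_pi_apply i hB)).trans
      (ae_of_all _ fun ω => ?_)
    exact (measurePreserving_eval (fun _ : Fin k => κ ω) i).measureReal_preimage
      hB.nullMeasurableSet
  have hint : ∀ i, Integrable (fun ω => M.compatCoef μ φ d j (Y t ω d i)) P := fun i =>
    Integrable.of_bound ((measurable_compatCoef hK hφ d j).comp (hmeas i)).aestronglyMeasurable
      (M.bound μ φ j) (ae_of_all _ fun _ => abs_compatCoef_le_bound hK hφ d j _)
  have e : (fun ω => M.sampleMean μ φ (fun s => Y s ω) t d j) =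
      (1 / (k : ℝ)) • ∑ i, fun ω => M.compatCoef μ φ d j (Y t ω d i) := by
    ext ω
    simp [sampleMean]
  rw [condMean, e]
  refine (condExp_smul _ _ _).trans ?_
  filter_upwards [condExp_finsetSum (s := Finset.univ) (fun i _ => hint i) (past Y t),
    ae_all_iff.mpr hone] with ω h1 h2
  rw [Pi.smul_apply, h1, Finset.sum_apply, Finset.sum_congr rfl fun i _ => h2 i]
  have hk' : (k : ℝ) ≠ 0 := by exact_mod_cast hk.ne'
  simp [hk', hκ]

/-- The random remainder in the averaged recursion for the squared errors. -/
def remainder (M : PairwiseMRF G X) (μ : Measure X) (φ : ℕ → X → ℝ) (r : ℕ) (P : Measure Ω)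
    (Y : ℕ → Ω → G.Dart → Fin k → X) (t : ℕ) (ω : Ω) (d : G.Dart) : ℝ :=
  8 * (∑ j : Fin r, M.bound μ φ j ^ 2) / t +
    ∑ j : Fin r, 2 * (1 / (t : ℝ) * ∑ s ∈ Finset.range t, M.noise μ φ P Y d j s ω) ^ 2

omit [DecidableEq V] in
theorem ae_tendsto_remainder (hK : M.HasBoundedKernels) (hφ : IsOrthonormalBasisL2 μ φ)
    (hY : ∀ t, Measurable (Y t)) :
    ∀ᵐ ω ∂P, ∀ d, Tendsto (fun t => M.remainder μ φ r P Y t ω d) atTop (𝓝 0) := by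
  have h : ∀ᵐ ω ∂P, ∀ (d : G.Dart) (j : Fin r), Tendsto (fun t : ℕ => 1 / (t : ℝ) *
      ∑ s ∈ Finset.range t, M.noise μ φ P Y d j s ω) atTop (𝓝 0) := by
    refine ae_all_iff.mpr fun d => ae_all_iff.mpr fun j => ?_
    exact ae_tendsto_average_of_orthogonal (aestronglyMeasurable_noise hK hφ hY d j)
      (abs_noise_le hK hφ d j) fun s t hst => integral_noise_mul_noise hK hφ hY d j hst
  filter_upwards [h] with ω hω d
  have h1 := tendsto_const_div_atTop_nhds_zero_nat (8 * (∑ j : Fin r, M.bound μ φ j ^ 2))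
  have h2 : Tendsto (fun t : ℕ => ∑ j : Fin r, 2 * (1 / (t : ℝ) *
      ∑ s ∈ Finset.range t, M.noise μ φ P Y d j s ω) ^ 2) atTop (𝓝 (∑ _j : Fin r, 2 * 0 ^ 2)) :=
    tendsto_finsetSum _ fun j _ => ((hω d j).pow 2).const_mul 2
  simpa [remainder] using h1.add h2

omit [DecidableEq V] in
theorem integrable_sq_average_noise (hK : M.HasBoundedKernels) (hφ : IsOrthonormalBasisL2 μ φ)
    (hY : ∀ t, Measurable (Y t)) (t : ℕ) (d : G.Dart) (j : ℕ) :
    Integrable (fun ω => 2 * (1 / (t : ℝ) *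
      ∑ s ∈ Finset.range t, M.noise μ φ P Y d j s ω) ^ 2) P := by
  simp_rw [mul_pow]
  exact ((integrable_sq_sum_range (aestronglyMeasurable_noise hK hφ hY d j)
    (abs_noise_le hK hφ d j) t).const_mul _).const_mul _

omit [DecidableEq V] in
theorem integrable_remainder (hK : M.HasBoundedKernels) (hφ : IsOrthonormalBasisL2 μ φ)
    (hY : ∀ t, Measurable (Y t)) (t : ℕ) (d : G.Dart) :
    Integrable (fun ω => M.remainder μ φ r P Y t ω d) P := by
  unfold remainder
  exact (integrable_const _).add
    (integrable_finsetSum _ fun j _ => integrable_sq_average_noise (P := P) hK hφ hY t d j)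

omit [DecidableEq V] in
theorem integral_remainder_le (hK : M.HasBoundedKernels) (hφ : IsOrthonormalBasisL2 μ φ)
    (hY : ∀ t, Measurable (Y t)) (t : ℕ) (d : G.Dart) :
    ∫ ω, M.remainder μ φ r P Y t ω d ∂P ≤ 16 * (∑ j : Fin r, M.bound μ φ j ^ 2) / t := by
  -- The noise is bounded by 2B_j, so it contributes 2(2B_j)²/t = 8B_j²/t; the other 8 of the total
  -- 16 is the first term of `remainder`.
  have h : ∀ j : Fin r, ∫ ω, 2 * (1 / (t : ℝ) *
      ∑ s ∈ Finset.range t, M.noise μ φ P Y d j s ω) ^ 2 ∂P ≤ 8 * M.bound μ φ j ^ 2 / t := by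
    intro j
    have := integral_sq_sum_range_le (aestronglyMeasurable_noise (P := P) hK hφ hY d j)
      (abs_noise_le hK hφ d j) (fun s t hst => integral_noise_mul_noise hK hφ hY d j hst) t
    simp_rw [mul_pow]
    rw [integral_const_mul, integral_const_mul]
    rcases Nat.eq_zero_or_pos t with rfl | ht
    · simp
    · have ht' : (0 : ℝ) < t := by exact_mod_cast ht
      calc _ ≤ 2 * ((1 / (t : ℝ)) ^ 2 * (t * (2 * M.bound μ φ j) ^ 2)) := by gcongr
        _ = _ := by
          field_simp
          ring
  unfold remainder
  have hint : ∀ j : Fin r, Integrable (fun ω => 2 * (1 / (t : ℝ) *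
      ∑ s ∈ Finset.range t, M.noise μ φ P Y d j s ω) ^ 2) P := fun j =>
    integrable_sq_average_noise hK hφ hY t d j
  rw [integral_add (integrable_const _) (integrable_finsetSum _ fun j _ => hint j),
    integral_finsetSum _ fun j _ => hint j]
  calc _ ≤ 8 * (∑ j : Fin r, M.bound μ φ j ^ 2) / t + ∑ j : Fin r, 8 * M.bound μ φ j ^ 2 / t := by
        refine add_le_add (by simp) (Finset.sum_le_sum fun j _ => h j)
    _ = _ := by
        rw [← Finset.sum_div, ← Finset.mul_sum]
        ring

omit [DecidableEq V] in
theorem integrable_estErrVec (hK : M.HasBoundedKernels) (hφ : IsOrthonormalBasisL2 μ φ)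
    (hY : ∀ t, Measurable (Y t)) {t : ℕ} (ht : 1 ≤ t) (d : G.Dart) :
    Integrable (fun ω => M.estErrVec μ φ r mstar (fun s => Y s ω) t d) P := by
  simp_rw [estErrVec_eq_sum hφ, sosmpCoef_eq_average _ ht]
  have hmean : ∀ (j : Fin r) (s : ℕ),
      MemLp (fun ω => M.sampleMean μ φ (fun s => Y s ω) s d j) 2 P := fun j s =>
    MemLp.of_bound (measurable_sampleMean hK hφ (hY s) d j).aestronglyMeasurable
      (M.bound μ φ j) (ae_of_all _ fun _ => abs_sampleMean_le hK hφ _ s d j)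
  have havg : ∀ j : Fin r, MemLp (fun ω => 1 / (t : ℝ) * ∑ s ∈ Finset.range t,
      M.sampleMean μ φ (fun s => Y s ω) s d j) 2 P := fun j =>
    (memLp_finsetSum _ fun s _ => hmean j s).const_mul _
  exact integrable_finsetSum _ fun j _ => ((havg j).sub (memLp_const _)).integrable_sq

/-- Almost surely, the squared errors satisfy an averaged recursion along the directed edges. -/
theorem ae_estErrVec_le (hK : M.HasBoundedKernels) (hφ : IsOrthonormalBasisL2 μ φ) (hk : 0 < k)
    (hfix : M.IsBPFixedPoint μ mstar) (hcond : M.ApproxCondition μ φ r mstar)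
    (hrun : M.IsSOSMPRun μ φ r k P Y) {N : Matrix G.Dart G.Dart ℝ}
    (hbias : ∀ d, ∀ a : G.Dart → Fin r → ℝ, (∀ f (j : Fin r), |a f j| ≤ M.bound μ φ j) →
      (∀ f x, 0 < expansion φ (a f) x) →
      IsProbabilityMeasure (M.sampleLaw μ φ a d) ∧
      ∑ j : Fin r, 2 * (∫ y, M.compatCoef μ φ d j y ∂(M.sampleLaw μ φ a d) -
          basisCoef μ φ (mstar d) j) ^ 2 ≤
        1 / 3 * (N *ᵥ ((fun f => normSqL2 μ fun x =>
          expansion φ (a f) x - projBasis μ φ r (mstar f) x) + approxErrVec μ φ r mstar)) d) :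
    ∀ᵐ ω ∂P, ∀ t : ℕ, 1 ≤ t → ∀ d,
      M.estErrVec μ φ r mstar (fun s => Y s ω) t d ≤
        1 / t * ∑ s ∈ Finset.Ico 1 t, 1 / 3 *
          (N *ᵥ (M.estErrVec μ φ r mstar (fun s => Y s ω) s + approxErrVec μ φ r mstar)) d +
        M.remainder μ φ r P Y t ω d := by
  have hb : ∀ ω {t : ℕ}, 1 ≤ t → ∀ d, _ := fun ω t ht d =>
    hbias d (M.sosmpCoef μ φ r (fun s => Y s ω) t)
      (abs_sosmpCoef_le hK hφ (fun s => Y s ω) ht)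
      (expansion_sosmpCoef_pos hcond hk (fun s => Y s ω) ht)
  have hcm : ∀ᵐ ω ∂P, ∀ (t : ℕ) (d : G.Dart) (j : Fin r), 1 ≤ t →
      M.condMean μ φ P Y d j t ω = ∫ y, M.compatCoef μ φ d j y
        ∂(M.sampleLaw μ φ (M.sosmpCoef μ φ r (fun s => Y s ω) t) d) := by
    refine ae_all_iff.mpr fun t => ae_all_iff.mpr fun d => ae_all_iff.mpr fun j => ?_
    by_cases ht : 1 ≤ t
    · filter_upwards [condMean_ae_eq hK hφ hk hrun (fun ω => (hb ω ht d).1) j] with ω hω _ using hω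
    · exact ae_of_all _ fun ω h => absurd h ht
  -- The messages with coefficients 1/r need not be positive, so the bias estimate is not available
  -- at s = 0. There the bias is only bounded by 2B_j, which costs 2(2B_j)² = 8B_j² once.
  have hcb : ∀ᵐ ω ∂P, ∀ (d : G.Dart) (j : Fin r),
      |M.condMean μ φ P Y d j 0 ω| ≤ M.bound μ φ j :=
    ae_all_iff.mpr fun d => ae_all_iff.mpr fun j => abs_condMean_le hK hφ d j 0
  filter_upwards [hcm, hcb] with ω hω hω0 t ht d
  have ht' : (0 : ℝ) < t := by exact_mod_cast ht
  set b : Fin r → ℕ → ℝ := fun j s => M.condMean μ φ P Y d j s ω - basisCoef μ φ (mstar d) j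
    with hbdef
  have hdec : ∀ j : Fin r, M.sosmpCoef μ φ r (fun s => Y s ω) t d j - basisCoef μ φ (mstar d) j =
      1 / (t : ℝ) * ∑ s ∈ Finset.range t, (b j s + M.noise μ φ P Y d j s ω) := by
    intro j
    have : ∀ s, b j s + M.noise μ φ P Y d j s ω =
        M.sampleMean μ φ (fun s => Y s ω) s d j - basisCoef μ φ (mstar d) j := fun s => by
      simp only [hbdef, noise]
      ring
    simp_rw [this]
    rw [Finset.sum_sub_distrib, sosmpCoef_eq_average _ ht]
    simp only [Finset.sum_const, Finset.card_range, nsmul_eq_mul]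
    field_simp
  have hzero : ∑ j : Fin r, 2 * b j 0 ^ 2 ≤ 8 * ∑ j : Fin r, M.bound μ φ j ^ 2 := by
    rw [Finset.mul_sum]
    refine Finset.sum_le_sum fun j _ => ?_
    have h1 : |b j 0| ≤ 2 * M.bound μ φ j :=
      (abs_sub _ _).trans (by linarith [hω0 d j, hfix.abs_basisCoef_le hK hφ d j])
    nlinarith [sq_le_sq' (abs_le.mp h1).1 (abs_le.mp h1).2]
  have hstep : ∀ s ∈ Finset.Ico 1 t, ∑ j : Fin r, 2 * b j s ^ 2 ≤ 1 / 3 *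
      (N *ᵥ (M.estErrVec μ φ r mstar (fun s => Y s ω) s + approxErrVec μ φ r mstar)) d := by
    intro s hs
    have hs1 := (Finset.mem_Ico.mp hs).1
    have h := (hb ω hs1 d).2
    simp only [hbdef, hω s d _ hs1]
    exact h
  have hsplit : ∑ j : Fin r, ∑ s ∈ Finset.range t, 2 * b j s ^ 2 =
      ∑ j : Fin r, 2 * b j 0 ^ 2 + ∑ s ∈ Finset.Ico 1 t, ∑ j : Fin r, 2 * b j s ^ 2 := by
    rw [Finset.sum_comm, Finset.range_eq_Ico,
      Finset.sum_eq_sum_Ico_succ_bot (Nat.lt_of_succ_le ht)]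
  rw [estErrVec_eq_sum hφ]
  calc ∑ j : Fin r, (M.sosmpCoef μ φ r (fun s => Y s ω) t d j - basisCoef μ φ (mstar d) j) ^ 2
      ≤ ∑ j : Fin r, (1 / (t : ℝ) * ∑ s ∈ Finset.range t, 2 * b j s ^ 2 +
        2 * (1 / (t : ℝ) * ∑ s ∈ Finset.range t, M.noise μ φ P Y d j s ω) ^ 2) := by
        refine Finset.sum_le_sum fun j _ => ?_
        rw [hdec]
        exact sq_average_add_le _ _
    _ = 1 / (t : ℝ) * (∑ j : Fin r, 2 * b j 0 ^ 2 +
          ∑ s ∈ Finset.Ico 1 t, ∑ j : Fin r, 2 * b j s ^ 2) +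
        ∑ j : Fin r, 2 * (1 / (t : ℝ) * ∑ s ∈ Finset.range t, M.noise μ φ P Y d j s ω) ^ 2 := by
        rw [Finset.sum_add_distrib, ← hsplit, Finset.mul_sum]
    _ ≤ 1 / (t : ℝ) * (8 * ∑ j : Fin r, M.bound μ φ j ^ 2 + ∑ s ∈ Finset.Ico 1 t, 1 / 3 *
          (N *ᵥ (M.estErrVec μ φ r mstar (fun s => Y s ω) s + approxErrVec μ φ r mstar)) d) +
        ∑ j : Fin r, 2 * (1 / (t : ℝ) * ∑ s ∈ Finset.range t, M.noise μ φ P Y d j s ω) ^ 2 := by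
        gcongr with s hs
        exact hstep s hs
    _ = _ := by
        rw [remainder]
        ring

omit [DecidableEq V] in
theorem integral_estErrVec_le (hK : M.HasBoundedKernels) (hφ : IsOrthonormalBasisL2 μ φ)
    (hY : ∀ t, Measurable (Y t)) {N : Matrix G.Dart G.Dart ℝ}
    (hrec : ∀ᵐ ω ∂P, ∀ t : ℕ, 1 ≤ t → ∀ d,
      M.estErrVec μ φ r mstar (fun s => Y s ω) t d ≤
        1 / t * ∑ s ∈ Finset.Ico 1 t, 1 / 3 *
          (N *ᵥ (M.estErrVec μ φ r mstar (fun s => Y s ω) s + approxErrVec μ φ r mstar)) d +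
        M.remainder μ φ r P Y t ω d) {t : ℕ} (ht : 1 ≤ t) (d : G.Dart) :
    (t : ℝ) * ∫ ω, M.estErrVec μ φ r mstar (fun s => Y s ω) t d ∂P ≤
      ∑ s ∈ Finset.Ico 1 t, 1 / 3 * (N *ᵥ ((fun f =>
        ∫ ω, M.estErrVec μ φ r mstar (fun s => Y s ω) s f ∂P) + approxErrVec μ φ r mstar)) d +
      16 * ∑ j : Fin r, M.bound μ φ j ^ 2 := by
  have ht' : (0 : ℝ) < t := by exact_mod_cast ht
  have hadd : ∀ s, 1 ≤ s → ∀ f, Integrable (fun ω =>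
      M.estErrVec μ φ r mstar (fun s => Y s ω) s f + approxErrVec μ φ r mstar f) P :=
    fun s hs f => (integrable_estErrVec hK hφ hY hs f).add (integrable_const _)
  have hint : ∀ s ∈ Finset.Ico 1 t, Integrable (fun ω => 1 / 3 *
      (N *ᵥ (M.estErrVec μ φ r mstar (fun s => Y s ω) s + approxErrVec μ φ r mstar)) d) P := by
    intro s hs
    refine Integrable.const_mul (integrable_finsetSum _ fun f _ => Integrable.const_mul ?_ _) _
    exact hadd s (Finset.mem_Ico.mp hs).1 f
  have hval : ∀ s ∈ Finset.Ico 1 t, ∫ ω, 1 / 3 *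
      (N *ᵥ (M.estErrVec μ φ r mstar (fun s => Y s ω) s + approxErrVec μ φ r mstar)) d ∂P =
      1 / 3 * (N *ᵥ ((fun f => ∫ ω, M.estErrVec μ φ r mstar (fun s => Y s ω) s f ∂P) +
        approxErrVec μ φ r mstar)) d := by
    intro s hs
    have hs1 := (Finset.mem_Ico.mp hs).1
    rw [integral_const_mul]
    simp only [mulVec, dotProduct, Pi.add_apply]
    rw [integral_finsetSum _ fun f _ => (hadd s hs1 f).const_mul _]
    congr 1
    refine Finset.sum_congr rfl fun f _ => ?_
    rw [integral_const_mul, integral_add (integrable_estErrVec hK hφ hY hs1 f) (integrable_const _)]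
    simp
  have hmono := integral_mono_ae (integrable_estErrVec (mstar := mstar) hK hφ hY ht d)
    (((integrable_finsetSum _ hint).const_mul (1 / (t : ℝ))).add
      (integrable_remainder hK hφ hY t d)) (hrec.mono fun ω h => h t ht d)
  simp only [Pi.add_apply] at hmono
  rw [integral_add ((integrable_finsetSum _ hint).const_mul _) (integrable_remainder hK hφ hY t d),
    integral_const_mul, integral_finsetSum _ hint, Finset.sum_congr rfl hval] at hmono
  have hR := integral_remainder_le (r := r) (P := P) hK hφ hY t d
  have h := mul_le_mul_of_nonneg_left (hmono.trans (add_le_add_right hR _)) ht'.le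
  refine h.trans (le_of_eq ?_)
  field_simp

end PairwiseMRF
end

/-- There is a nonnegative matrix, supported on the incoming directed edges, that controls the bias
of the sampled coefficients for all admissible messages. -/
theorem PairwiseMRF.exists_biasMatrix {V : Type*} [Fintype V] [DecidableEq V] {G : SimpleGraph V}
    [DecidableRel G.Adj] {X : Type*} [MeasurableSpace X] {M : PairwiseMRF G X} {μ : Measure X}
    [IsFiniteMeasure μ] {φ : ℕ → X → ℝ} {r : ℕ} {mstar : G.Dart → X → ℝ}
    (hK : M.HasBoundedKernels) (hφ : IsOrthonormalBasisL2 μ φ)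
    (hφ_bdd : ∀ j < r, ∃ C : ℝ, ∀ x, |φ j x| ≤ C) (hfix : M.IsBPFixedPoint μ mstar) :
    ∃ N : Matrix G.Dart G.Dart ℝ, (∀ d f, 0 ≤ N d f) ∧ (∀ d f, N d f ≠ 0 → f ∈ incoming G d) ∧
      ∀ d, ∀ a : G.Dart → Fin r → ℝ, (∀ f (j : Fin r), |a f j| ≤ M.bound μ φ j) →
        (∀ f x, 0 < expansion φ (a f) x) →
        IsProbabilityMeasure (M.sampleLaw μ φ a d) ∧
        ∑ j : Fin r, 2 * (∫ y, M.compatCoef μ φ d j y ∂(M.sampleLaw μ φ a d) -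
            basisCoef μ φ (mstar d) j) ^ 2 ≤
          1 / 3 * (N *ᵥ ((fun f => normSqL2 μ fun x =>
            expansion φ (a f) x - projBasis μ φ r (mstar f) x) + approxErrVec μ φ r mstar)) d := by
  choose κ hκ0 hκ using exists_bias_le (r := r) hK hφ hφ_bdd hfix
  -- The factor 6 = 2 · 3 combines the 2 in front of the squared bias with the 1/3 kept in front of
  -- N.
  refine ⟨fun d f => if f ∈ incoming G d then
    6 * (∑ j : Fin r, M.bound μ φ j ^ 2) * κ d else 0, fun d f => ?_, fun d f h => ?_,
    fun d a ha hpos => ⟨(hκ d a ha hpos).1, ?_⟩⟩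
  · have := hκ0 d
    dsimp only
    split_ifs <;> positivity
  · by_contra hcon
    simp [hcon] at h
  · refine (Finset.sum_le_sum fun (j : Fin r) _ => mul_le_mul_of_nonneg_left ((hκ d a ha hpos).2 (j : ℕ))
      zero_le_two).trans (le_of_eq ?_)
    simp only [mulVec, dotProduct, ite_mul, zero_mul, Finset.sum_ite_mem, Finset.univ_inter]
    rw [← Finset.mul_sum, ← Finset.sum_mul, ← Finset.mul_sum]
    simp only [Pi.add_apply]
    ring

/-! ### Assembly of the theorem. -/

theorem theorem1 {E : Type*} [MetricSpace E] [ProperSpace E] [MeasurableSpace E] [BorelSpace E]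
    (S : Set E) (hS_closed : IsClosed S) (hS_bdd : Bornology.IsBounded S)
    (μ : Measure S) [IsFiniteMeasure μ]
    {V : Type*} [Fintype V] [DecidableEq V] (G : SimpleGraph V) [DecidableRel G.Adj]
    (hG : G.IsAcyclic)
    (M : PairwiseMRF G S)
    (hnode : ∀ v, Continuous (M.nodePot v))
    (hedge : ∀ u v, G.Adj u v → Continuous fun p : S × S => M.edgePot u v p.1 p.2)
    (φ : ℕ → S → ℝ) (hφ : IsOrthonormalBasisL2 μ φ)
    (r : ℕ) (hr : 0 < r) (hφ_bdd : ∀ j < r, ∃ C : ℝ, ∀ x, |φ j x| ≤ C)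
    (mstar : G.Dart → S → ℝ) (hfix : M.IsBPFixedPoint μ mstar)
    (hcond : M.ApproxCondition μ φ r mstar) :
    ∃ N : Matrix G.Dart G.Dart ℝ,
      -- structure of `N`
      (∀ d f, 0 ≤ N d f) ∧
      (∀ d f, N d f ≠ 0 → f ∈ incoming G d) ∧
      IsNilpotent N ∧
      (∀ ℓ : ℕ, (∀ (u v : V) (p : G.Walk u v), p.IsPath → p.length ≤ ℓ) → N ^ ℓ = 0) ∧
      -- every run of the algorithm, with any number of samples per update
      ∀ (k : ℕ), 0 < k → ∀ (Ω : Type*) [MeasurableSpace Ω] (P : Measure Ω) [IsProbabilityMeasure P]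
        (Y : ℕ → Ω → G.Dart → Fin k → S), M.IsSOSMPRun μ φ r k P Y →
        -- (a) almost sure convergence to the set
        (∀ᵐ ω ∂P, Tendsto
          (fun t : ℕ => Metric.infDist
            (WithLp.toLp 2 (M.estErrVec μ φ r mstar (fun s => Y s ω) t))
            (errBall N (PairwiseMRF.approxErrVec μ φ r mstar)))
          atTop (𝓝 0)) ∧
        -- (b) bound in expectation
        (∀ t : ℕ, 1 ≤ t → ∀ d : G.Dart,
          Integrable (fun ω => M.estErrVec μ φ r mstar (fun s => Y s ω) t d) P ∧
          ∫ ω, M.estErrVec μ φ r mstar (fun s => Y s ω) t d ∂P ≤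
            (6 * ∑ j : Fin r, M.bound μ φ j ^ 2) *
                (((1 - Real.log (t : ℝ) • N)⁻¹ *ᵥ
                    (N *ᵥ (fun _ => (1 : ℝ)) + fun _ => (16 : ℝ))) d / (t : ℝ)) +
              errFloor N (PairwiseMRF.approxErrVec μ φ r mstar) d) ∧
        -- the resulting rate
        (∀ n : ℕ, N ^ (n + 1) = 0 → ∀ d : G.Dart,
          (fun t : ℕ => max 0 (∫ ω, M.estErrVec μ φ r mstar (fun s => Y s ω) t d ∂P -
              errFloor N (PairwiseMRF.approxErrVec μ φ r mstar) d))
            =O[atTop] fun t : ℕ => Real.log t ^ n / t) := by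
  have : CompactSpace S :=
    isCompact_iff_compactSpace.mp (Metric.isCompact_of_isClosed_isBounded hS_closed hS_bdd)
  have hK := PairwiseMRF.hasBoundedKernels M hnode hedge
  -- N is fixed here, before the number of samples and the probability space are introduced.
  obtain ⟨N, hN0, hNinc, hbias⟩ := PairwiseMRF.exists_biasMatrix hK hφ hφ_bdd hfix
  obtain ⟨m, hm⟩ := isNilpotent_of_isAcyclic hG hNinc
  refine ⟨N, hN0, hNinc, ⟨m, hm⟩, pow_eq_zero_of_isAcyclic hG hNinc, ?_⟩
  intro k hk Ω _ P _ Y hrun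
  have hρ : ∀ d, 0 ≤ PairwiseMRF.approxErrVec μ φ r mstar d := PairwiseMRF.approxErrVec_nonneg
  have hF := errFloor_nonneg hN0 hm hρ
  have hrec := PairwiseMRF.ae_estErrVec_le hK hφ hk hfix hcond hrun hbias
  have hexp : ∀ t : ℕ, 1 ≤ t → ∀ d, _ := fun t ht d => le_of_averaged_recursion hN0 hm hρ
    (x := fun s f => ∫ ω, M.estErrVec μ φ r mstar (fun s => Y s ω) s f ∂P)
    (S := ∑ j : Fin r, M.bound μ φ j ^ 2) (Finset.sum_nonneg fun _ _ => sq_nonneg _)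
    (fun t ht d => PairwiseMRF.integral_estErrVec_le hK hφ hrun.1 hrec ht d) ht d
  refine ⟨?_, fun t ht d => ⟨PairwiseMRF.integrable_estErrVec hK hφ hrun.1 ht d, hexp t ht d⟩,
    fun n hn d => ?_⟩
  -- Along almost every trajectory the recursion is deterministic with vanishing remainder, so every
  -- entry's excess over the floor tends to 0, and their sum dominates the distance to the box.
  · filter_upwards [hrec, PairwiseMRF.ae_tendsto_remainder (r := r) hK hφ hrun.1] with ω hω hR
    have hlim := tendsto_posPart_of_averaged_recursion hN0 hm hρ hR hω
    have hsum := tendsto_finsetSum Finset.univ fun d _ => hlim d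
    rw [Finset.sum_const_zero] at hsum
    exact squeeze_zero (fun _ => Metric.infDist_nonneg)
      (fun t => infDist_errBall_le hF fun d => PairwiseMRF.estErrVec_nonneg _ t d) hsum
  · refine Asymptotics.IsBigO.trans (Asymptotics.IsBigO.of_bound' ?_)
      ((isBigO_log_pow_div hn (N *ᵥ (fun _ => (1 : ℝ)) + fun _ => (16 : ℝ)) d).const_mul_left
        (6 * ∑ j : Fin r, M.bound μ φ j ^ 2))
    filter_upwards [eventually_ge_atTop 1] with t ht
    have h := hexp t ht d
    rw [Real.norm_of_nonneg (le_max_left _ _)]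
    refine max_le (norm_nonneg _) (le_trans ?_ (le_abs_self _))
    linarith
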